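/- For $L>0$ let $R_L=(0,L)\times(0,1/L)\subset\mathbb{R}^2$, and let $\Delta_L$ be the (positive) Dirichlet Laplacian on $L^2(R_L)$, i.e. the Friedrichs extension of $-(\partial_1^2+\partial_2^2)$ on $C_c^\infty(R_L)$. Let $\zeta_L(s)=\sum_k\lambda_k^{-s}$, $\operatorname{Re}s>1$, be its spectral zeta function, where $\lambda_1\le\lambda_2\le\dots$ are the positive eigenvalues of $\Delta_L$ repeated according to their (finite) multiplicity. Then for every $L>0$ the series converges for $\operatorname{Re}s>1$, $\zeta_L$ has a meromorphic continuation to $\mathbb{C}$ that is holomorphic at $s=0$, so that the zeta-regularized determinant $\det\Delta_L:=e^{-\zeta_L'(0)}$ is well defined, it is a real number, and $$\det\Delta_L=\left(\frac{|\eta(i/L^2)|^{2}}{2L}\right)^{1/2}=\frac{|\eta(i/L^2)|}{\sqrt{2L}},$$ where $\eta(z)=e^{\pi i z/12}\prod_{n\ge1}(1-e^{2\pi i n z})$ is the Dedekind eta function. Moreover, $\det\Delta_L$ is uniquely maximized at $L=1$, i.e. $\det\Delta_L<\det\Delta_1$ for all $L>0$ with $L\ne1$, and $\det\Delta_L\to0$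 as $L\to0^+$ and as $L\to\infty$. -/

import Mathlib

open MeasureTheory TopologicalSpace
open scoped Distributions Gradient

noncomputable section

namespace DirichletDet

/-- The Euclidean plane. -/
abbrev Plane : Type := EuclideanSpace ℝ (Fin 2)

/-- The real Hilbert space `L²(Ω)` for Lebesgue measure on `Ω`. -/
abbrev L2 (Ω : Opens Plane) : Type :=
  Lp ℝ 2 ((volume : Measure Plane).restrict (Ω : Set Plane))

/-- The real Hilbert space `L²(Ω; ℝ²)` of square integrable vector fields on `Ω`. -/
abbrev L2Vec (Ω : Opens Plane) : Type :=
  Lp Plane 2 ((volume : Measure Plane).restrict (Ω : Set Plane))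

lemma testFunction_differentiable {Ω : Opens Plane} (φ : 𝓓(Ω, ℝ)) :
    Differentiable ℝ (φ : Plane → ℝ) :=
  φ.contDiff.differentiable (by simp)

/-- The pairs `(φ, ∇φ)`, as classes in `L²(Ω) × L²(Ω; ℝ²)`, for smooth functions `φ` with compact
support in `Ω`. -/
def testGradientGraph (Ω : Opens Plane) : Submodule ℝ (L2 Ω × L2Vec Ω) where
  carrier := {p | ∃ φ : 𝓓(Ω, ℝ),
    (p.1 : Plane → ℝ) =ᵐ[volume.restrict (Ω : Set Plane)] (φ : Plane → ℝ) ∧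
    (p.2 : Plane → Plane) =ᵐ[volume.restrict (Ω : Set Plane)] ∇ (φ : Plane → ℝ)}
  zero_mem' := by
    refine ⟨0, ?_, ?_⟩
    · filter_upwards [Lp.coeFn_zero ℝ 2 (volume.restrict (Ω : Set Plane))] with x hx
      simpa using hx
    · filter_upwards [Lp.coeFn_zero Plane 2 (volume.restrict (Ω : Set Plane))] with x hx
      have h0 : ((0 : 𝓓(Ω, ℝ)) : Plane → ℝ) = fun _ => 0 := by ext; simp
      rw [h0, gradient_fun_const]
      simpa using hx
  add_mem' := by
    rintro p q ⟨φ, h1, h2⟩ ⟨ψ, h3, h4⟩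
    refine ⟨φ + ψ, ?_, ?_⟩
    · filter_upwards [h1, h3, Lp.coeFn_add p.1 q.1] with x a b c
      simp only [Prod.fst_add, c, Pi.add_apply, a, b, FunLike.coe_add]
    · filter_upwards [h2, h4, Lp.coeFn_add p.2 q.2] with x a b c
      have h : ((φ + ψ : 𝓓(Ω, ℝ)) : Plane → ℝ) = (φ : Plane → ℝ) + (ψ : Plane → ℝ) := by
        ext; simp
      rw [Prod.snd_add, c, Pi.add_apply, a, b, h, gradient, gradient, gradient,
        fderiv_add (testFunction_differentiable φ x) (testFunction_differentiable ψ x), map_add]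
  smul_mem' := by
    rintro c p ⟨φ, h1, h2⟩
    refine ⟨c • φ, ?_, ?_⟩
    · filter_upwards [h1, Lp.coeFn_smul c p.1] with x a b
      simp only [Prod.smul_fst, b, Pi.smul_apply, a, FunLike.coe_smul]
    · filter_upwards [h2, Lp.coeFn_smul c p.2] with x a b
      have h : ((c • φ : 𝓓(Ω, ℝ)) : Plane → ℝ) = c • (φ : Plane → ℝ) := by
        ext; simp
      rw [Prod.smul_snd, b, Pi.smul_apply, a, h, gradient, gradient,
        fderiv_const_smul (testFunction_differentiable φ x) c]
      simp

/-- The Sobolev space `H¹₀(Ω)`, each element `u` being recorded together with its weak gradient: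
the closure of the pairs `(φ, ∇φ)` in `L²(Ω) × L²(Ω; ℝ²)`. -/
def sobolevH10 (Ω : Opens Plane) : Submodule ℝ (L2 Ω × L2Vec Ω) :=
  (testGradientGraph Ω).topologicalClosure

/-- The graph of the (positive) Dirichlet Laplacian on `Ω`, the Friedrichs extension of
`-(∂₁² + ∂₂²)` on smooth functions with compact support in `Ω`: the pairs `(u, f)` with
`u ∈ H¹₀(Ω)`, `f ∈ L²(Ω)` and `∫ ∇u · ∇v = ∫ f v` for all `v ∈ H¹₀(Ω)`. -/
def dirichletLaplacian (Ω : Opens Plane) : Submodule ℝ (L2 Ω × L2 Ω) where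
  carrier := {p | ∃ G : L2Vec Ω, (p.1, G) ∈ sobolevH10 Ω ∧
    ∀ w ∈ sobolevH10 Ω, inner ℝ G w.2 = inner ℝ p.2 w.1}
  zero_mem' := ⟨0, (sobolevH10 Ω).zero_mem, by simp⟩
  add_mem' := by
    rintro p q ⟨G, hG, h⟩ ⟨K, hK, k⟩
    refine ⟨G + K, (sobolevH10 Ω).add_mem hG hK, fun w hw => ?_⟩
    rw [inner_add_left, h w hw, k w hw, Prod.snd_add, inner_add_left]
  smul_mem' := by
    rintro c p ⟨G, hG, h⟩
    refine ⟨c • G, (sobolevH10 Ω).smul_mem c hG, fun w hw => ?_⟩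
    rw [real_inner_smul_left, h w hw, Prod.smul_snd, real_inner_smul_left]

/-- The solutions `u` of `Δ u = μ u` for the Dirichlet Laplacian `Δ` on `Ω`. -/
def eigenspace (Ω : Opens Plane) (μ : ℝ) : Submodule ℝ (L2 Ω) :=
  (dirichletLaplacian Ω).comap (LinearMap.prod LinearMap.id (μ • LinearMap.id))

/-- The set of positive eigenvalues of the Dirichlet Laplacian on `Ω`, without multiplicity. -/
def positiveEigenvalues (Ω : Opens Plane) : Set ℝ :=
  {μ | 0 < μ ∧ eigenspace Ω μ ≠ ⊥}

/-- `Z` is the spectral zeta function of the Dirichlet Laplacian on the planar domain `Ω`, continued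
to a neighbourhood of `0`: all eigenvalues have finite multiplicity; the sum of `μ ^ (-s)` over the
positive eigenvalues, with multiplicity, converges to `Z s` for `Re s > 1`; `Z` is meromorphic
on `ℂ` and holomorphic at `0`. -/
structure IsSpectralZeta (Ω : Opens Plane) (Z : ℂ → ℂ) : Prop where
  finite_mult : ∀ μ ∈ positiveEigenvalues Ω, FiniteDimensional ℝ (eigenspace Ω μ)
  hasSum : ∀ s : ℂ, 1 < s.re →
    HasSum (fun μ : positiveEigenvalues Ω =>
      (Module.finrank ℝ (eigenspace Ω (μ : ℝ)) : ℂ) * ((μ : ℝ) : ℂ) ^ (-s)) (Z s)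
  meromorphic : MeromorphicOn Z Set.univ
  analyticAt_zero : AnalyticAt ℂ Z 0

/-- `d` is the zeta-regularized determinant `exp (-ζ'(0))` of the Dirichlet Laplacian on `Ω`. -/
def IsZetaDeterminant (Ω : Opens Plane) (d : ℝ) : Prop :=
  ∃ Z : ℂ → ℂ, IsSpectralZeta Ω Z ∧ (d : ℂ) = Complex.exp (-deriv Z 0)

open Classical in
/-- The zeta-regularized determinant of the Dirichlet Laplacian on `Ω` (`0` if there is none). -/
def zetaDet (Ω : Opens Plane) : ℝ :=
  if h : ∃ d, IsZetaDeterminant Ω d then h.choose else 0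

/-- The open rectangle `(0, L) × (0, 1/L)`. -/
def rectangle (L : ℝ) : Opens Plane where
  carrier := {x | 0 < x 0 ∧ x 0 < L ∧ 0 < x 1 ∧ x 1 < L⁻¹}
  is_open' := by
    have c (i : Fin 2) : Continuous fun x : Plane => x i := by fun_prop
    exact (isOpen_lt continuous_const (c 0)).inter ((isOpen_lt (c 0) continuous_const).inter
      ((isOpen_lt continuous_const (c 1)).inter (isOpen_lt (c 1) continuous_const)))

end DirichletDet

end

noncomputable section

namespace DirichletDet

open Filter Set Topology Asymptotics

/-! The eigenfunctions are `sin (mπx/L) sin (nπLy)` with `m, n ≥ 1`, so the spectral zeta function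
is the double series `∑ (A m² + B n²)^(-s)` with `A = (π/L)²` and `B = (πL)²`. Times `Γ(s)`, it is
the Mellin transform of the heat trace `theta A t * theta B t`. Poisson summation in the factor
`theta B` (`theta_functional`) leaves two explicit terms in the Riemann zeta function and a
remainder that is exponentially small at both ends of `(0, ∞)`, whose Mellin transform is entire.
This is the continuation (`hasSum_rectZeta`).

Since `1/Γ` has a simple zero with slope `1` at `0`, the derivative there only needs the value of
the remainder's Mellin transform at `0`. Termwise this is an elementary integral
(`integral_inv_mul_inv_sqrt_mul_exp`), and it sums to `S(r) = ∑ exp(-2πmkr)/k` with `r = √(A/B) =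
1/L²`. Thus `-ζ'(0) = log A/4 - log(2π)/2 - πr/12 - S(r)`, and `πr/12 + S(r) = -log |η(ir)|` by
expanding the logarithm of the eta product.

Up to a constant, `log det` is `logDet r = log r/4 - πr/12 - S(r)`. It is strictly concave, as `S`
is convex, and it is invariant under `r ↦ 1/r`, because exchanging `A` and `B` does not change the
double series. As `1` is a weighted mean of `r` and `1/r`, the unique maximum is at `r = 1`. The
linear term forces `-∞` as `r → ∞`, and the symmetry handles `r → 0`.

For the spectrum, cutoffs put the sine products in `H¹₀`, integration by parts makes them orthogonal
eigenfunctions, and Stone–Weierstrass makes them complete (`eq_zero_of_inner_eigenMode_eq_zero`), so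
they span every eigenspace (`eigenspace_eq_span`). -/

/-! ### The integral of `t ^ (-3/2) * exp (-a² t - b² / t)` -/

/-- The error function without its normalizing factor. -/
def gaussPrimitive (x : ℝ) : ℝ := ∫ u in (0 : ℝ)..x, Real.exp (-u ^ 2)

lemma hasDerivAt_gaussPrimitive (x : ℝ) :
    HasDerivAt gaussPrimitive (Real.exp (-x ^ 2)) x :=
  (show Continuous fun u : ℝ => Real.exp (-u ^ 2) by fun_prop).integral_hasStrictDerivAt 0 x
    |>.hasDerivAt

lemma gaussPrimitive_neg (x : ℝ) : gaussPrimitive (-x) = -gaussPrimitive x := by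
  have h := intervalIntegral.integral_comp_neg (a := 0) (b := x)
    (fun u : ℝ => Real.exp (-u ^ 2))
  simp only [neg_sq, neg_zero] at h
  rw [gaussPrimitive, gaussPrimitive, intervalIntegral.integral_symm, h]

lemma tendsto_gaussPrimitive_atTop :
    Tendsto gaussPrimitive atTop (𝓝 (√Real.pi / 2)) := by
  have hi : IntegrableOn (fun u : ℝ => Real.exp (-u ^ 2)) (Ioi 0) := by
    simpa using (integrable_exp_neg_mul_sq one_pos).integrableOn (s := Ioi (0 : ℝ))
  have h := intervalIntegral_tendsto_integral_Ioi 0 hi tendsto_id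
  have e : ∫ u in Ioi (0 : ℝ), Real.exp (-u ^ 2) = √Real.pi / 2 := by
    simpa using integral_gaussian_Ioi 1
  rw [e] at h
  exact h

lemma tendsto_gaussPrimitive_atBot :
    Tendsto gaussPrimitive atBot (𝓝 (-(√Real.pi / 2))) := by
  have h := (tendsto_gaussPrimitive_atTop.comp tendsto_neg_atBot_atTop).neg
  refine h.congr fun x => ?_
  simp [gaussPrimitive_neg]

/-- An antiderivative of `t ^ (-3/2) * exp (-a² t - b² / t)`. -/
def besselPrimitive (a b t : ℝ) : ℝ :=
  b⁻¹ * (Real.exp (-(2 * a * b)) * gaussPrimitive (a * √t - b * (√t)⁻¹) -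
    Real.exp (2 * a * b) * gaussPrimitive (a * √t + b * (√t)⁻¹))

/-- Completing the square turns both products of exponentials into the same factor `exp (-a² t - b²
/ t)`. In the difference, the derivatives of `a * √t` cancel and those of `b * (√t)⁻¹` add up. -/
lemma hasDerivAt_besselPrimitive {a b t : ℝ} (hb : 0 < b) (ht : 0 < t) :
    HasDerivAt (besselPrimitive a b)
      (t⁻¹ * (√t)⁻¹ * Real.exp (-(a ^ 2 * t) - b ^ 2 * t⁻¹)) t := by
  have hs : 0 < √t := Real.sqrt_pos.2 ht
  have hst : √t ^ 2 = t := Real.sq_sqrt ht.le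
  have hsi : √t * (√t)⁻¹ = 1 := mul_inv_cancel₀ hs.ne'
  have hi2 : (√t)⁻¹ ^ 2 = t⁻¹ := by rw [inv_pow, hst]
  have d1 : HasDerivAt (fun t => √t) (1 / (2 * √t)) t := Real.hasDerivAt_sqrt ht.ne'
  have d2 := d1.inv hs.ne'
  have dm := (hasDerivAt_gaussPrimitive (a * √t - b * (√t)⁻¹)).comp t
    ((d1.const_mul a).sub (d2.const_mul b))
  have dp := (hasDerivAt_gaussPrimitive (a * √t + b * (√t)⁻¹)).comp t
    ((d1.const_mul a).add (d2.const_mul b))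
  have := ((dm.const_mul (Real.exp (-(2 * a * b)))).sub
    (dp.const_mul (Real.exp (2 * a * b)))).const_mul b⁻¹
  refine this.congr_deriv ?_
  have e1 : Real.exp (-(2 * a * b)) * Real.exp (-(a * √t - b * (√t)⁻¹) ^ 2) =
      Real.exp (-(a ^ 2 * t) - b ^ 2 * t⁻¹) := by
    rw [← Real.exp_add]
    congr 1
    linear_combination (2 * a * b) * hsi - a ^ 2 * hst - b ^ 2 * hi2
  have e2 : Real.exp (2 * a * b) * Real.exp (-(a * √t + b * (√t)⁻¹) ^ 2) =
      Real.exp (-(a ^ 2 * t) - b ^ 2 * t⁻¹) := by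
    rw [← Real.exp_add]
    congr 1
    linear_combination -(2 * a * b) * hsi - a ^ 2 * hst - b ^ 2 * hi2
  rw [← mul_assoc, ← mul_assoc, e1, e2, ← mul_sub, hst]
  field_simp
  ring

lemma tendsto_besselPrimitive_atTop {a : ℝ} (b : ℝ) (ha : 0 < a) :
    Tendsto (besselPrimitive a b) atTop (𝓝 (b⁻¹ * (Real.exp (-(2 * a * b)) * (√Real.pi / 2) -
      Real.exp (2 * a * b) * (√Real.pi / 2)))) := by
  have h1 : Tendsto (fun t : ℝ => a * √t) atTop atTop :=
    Real.tendsto_sqrt_atTop.const_mul_atTop ha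
  have h2 : Tendsto (fun t : ℝ => b * (√t)⁻¹) atTop (𝓝 0) := by
    simpa using (tendsto_inv_atTop_zero.comp Real.tendsto_sqrt_atTop).const_mul b
  have hm : Tendsto (fun t : ℝ => a * √t - b * (√t)⁻¹) atTop atTop := by
    simpa [sub_eq_add_neg] using h1.atTop_add h2.neg
  have hp : Tendsto (fun t : ℝ => a * √t + b * (√t)⁻¹) atTop atTop := h1.atTop_add h2
  exact (((tendsto_gaussPrimitive_atTop.comp hm).const_mul _).sub
    ((tendsto_gaussPrimitive_atTop.comp hp).const_mul _)).const_mul _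

lemma tendsto_besselPrimitive_zero (a : ℝ) {b : ℝ} (hb : 0 < b) :
    Tendsto (besselPrimitive a b) (𝓝[>] 0) (𝓝 (b⁻¹ * (Real.exp (-(2 * a * b)) *
      (-(√Real.pi / 2)) - Real.exp (2 * a * b) * (√Real.pi / 2)))) := by
  have h0 : Tendsto (fun t : ℝ => √t) (𝓝[>] 0) (𝓝[>] 0) := by
    refine tendsto_nhdsWithin_iff.2 ⟨?_, ?_⟩
    · simpa using (Real.continuous_sqrt.tendsto 0).mono_left nhdsWithin_le_nhds
    · filter_upwards [self_mem_nhdsWithin] with t ht using Real.sqrt_pos.2 ht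
  have h1 : Tendsto (fun t : ℝ => a * √t) (𝓝[>] 0) (𝓝 0) := by
    simpa using (h0.mono_right nhdsWithin_le_nhds).const_mul a
  have h2 : Tendsto (fun t : ℝ => b * (√t)⁻¹) (𝓝[>] 0) atTop :=
    (tendsto_inv_nhdsGT_zero.comp h0).const_mul_atTop hb
  have hm : Tendsto (fun t : ℝ => a * √t - b * (√t)⁻¹) (𝓝[>] 0) atBot := by
    simpa [sub_eq_add_neg] using h1.add_atBot (tendsto_neg_atTop_atBot.comp h2)
  have hp : Tendsto (fun t : ℝ => a * √t + b * (√t)⁻¹) (𝓝[>] 0) atTop := h1.add_atTop h2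
  exact (((tendsto_gaussPrimitive_atBot.comp hm).const_mul _).sub
    ((tendsto_gaussPrimitive_atTop.comp hp).const_mul _)).const_mul _

/-- This is the half-integer Bessel integral `K_{1/2}`, which is elementary. The primitive has the
same `exp (2ab)` term at both ends, so only `exp (-2ab)` survives. -/
lemma integral_inv_mul_inv_sqrt_mul_exp {a b : ℝ} (ha : 0 < a) (hb : 0 < b) :
    IntegrableOn (fun t : ℝ => t⁻¹ * (√t)⁻¹ * Real.exp (-(a ^ 2 * t) - b ^ 2 * t⁻¹)) (Ioi 0) ∧
    ∫ t in Ioi (0 : ℝ), t⁻¹ * (√t)⁻¹ * Real.exp (-(a ^ 2 * t) - b ^ 2 * t⁻¹) =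
      √Real.pi / b * Real.exp (-(2 * a * b)) := by
  set l := b⁻¹ * (Real.exp (-(2 * a * b)) *
      (-(√Real.pi / 2)) - Real.exp (2 * a * b) * (√Real.pi / 2)) with hl
  -- As `(√0)⁻¹ = 0` by convention, the primitive takes the value `0` at `0` instead of its right
  -- limit `l`; the value is corrected to get continuity there.
  set g := Function.update (besselPrimitive a b) 0 l with hg
  have hne : ∀ t ∈ Ioi (0 : ℝ), g =ᶠ[𝓝 t] besselPrimitive a b := fun t ht => by
    filter_upwards [isOpen_ne.mem_nhds (ne_of_gt ht : t ≠ 0)] with x hx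
    exact Function.update_of_ne hx _ _
  have hcont : ContinuousWithinAt g (Ici 0) 0 := by
    rw [continuousWithinAt_update_same]
    simpa only [Ici_sdiff_left] using tendsto_besselPrimitive_zero a hb
  have hderiv : ∀ t ∈ Ioi (0 : ℝ), HasDerivAt g
      (t⁻¹ * (√t)⁻¹ * Real.exp (-(a ^ 2 * t) - b ^ 2 * t⁻¹)) t := fun t ht =>
    (hasDerivAt_besselPrimitive hb ht).congr_of_eventuallyEq (hne t ht)
  have hpos : ∀ t ∈ Ioi (0 : ℝ),
      0 ≤ t⁻¹ * (√t)⁻¹ * Real.exp (-(a ^ 2 * t) - b ^ 2 * t⁻¹) := fun t ht => by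
    have : 0 < t := ht
    positivity
  have htop : Tendsto g atTop (𝓝 (b⁻¹ * (Real.exp (-(2 * a * b)) * (√Real.pi / 2) -
      Real.exp (2 * a * b) * (√Real.pi / 2)))) := by
    refine (tendsto_besselPrimitive_atTop b ha).congr' ?_
    filter_upwards [eventually_gt_atTop 0] with t ht
    exact (hne t ht).eq_of_nhds.symm
  refine ⟨integrableOn_Ioi_deriv_of_nonneg hcont hderiv hpos htop, ?_⟩
  rw [integral_Ioi_of_hasDerivAt_of_nonneg hcont hderiv hpos htop, hg, Function.update_self, hl]
  field_simp
  ring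

/-! ### A one-dimensional heat trace -/

/-- The heat trace `∑ exp (-c n² t)` over positive integers `n`. -/
def theta (c t : ℝ) : ℝ := ∑' n : ℕ, Real.exp (-(c * (n + 1) ^ 2) * t)

lemma exp_neg_mul_sq_le {c t : ℝ} (hc : 0 < c) (ht : 0 < t) (n : ℕ) :
    Real.exp (-(c * ((n : ℝ) + 1) ^ 2) * t) ≤ Real.exp (-c * t) * Real.exp (-c * t) ^ n := by
  rw [← Real.exp_nat_mul, ← Real.exp_add, Real.exp_le_exp]
  have : 0 < c * t := mul_pos hc ht
  have hn : (0 : ℝ) ≤ n := n.cast_nonneg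
  nlinarith [mul_nonneg this.le (mul_nonneg hn hn), mul_nonneg this.le hn]

lemma exp_neg_mul_lt_one {c t : ℝ} (hc : 0 < c) (ht : 0 < t) : Real.exp (-c * t) < 1 := by
  rw [Real.exp_lt_one_iff]
  nlinarith [mul_pos hc ht]

lemma summable_theta {c t : ℝ} (hc : 0 < c) (ht : 0 < t) :
    Summable fun n : ℕ => Real.exp (-(c * ((n : ℝ) + 1) ^ 2) * t) :=
  Summable.of_nonneg_of_le (fun _ => (Real.exp_pos _).le) (exp_neg_mul_sq_le hc ht)
    ((summable_geometric_of_lt_one (Real.exp_pos _).le (exp_neg_mul_lt_one hc ht)).mul_left _)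

lemma hasSum_theta {c t : ℝ} (hc : 0 < c) (ht : 0 < t) :
    HasSum (fun n : ℕ => Real.exp (-(c * ((n : ℝ) + 1) ^ 2) * t)) (theta c t) :=
  (summable_theta hc ht).hasSum

lemma theta_nonneg (c t : ℝ) : 0 ≤ theta c t := tsum_nonneg fun _ => (Real.exp_pos _).le

lemma theta_le {c t : ℝ} (hc : 0 < c) (ht : 0 < t) :
    theta c t ≤ Real.exp (-c * t) * (1 - Real.exp (-c * t))⁻¹ := by
  have h1 := exp_neg_mul_lt_one hc ht
  rw [← tsum_geometric_of_lt_one (Real.exp_pos _).le h1, ← tsum_mul_left]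
  exact Summable.tsum_le_tsum (exp_neg_mul_sq_le hc ht) (summable_theta hc ht)
    ((summable_geometric_of_lt_one (Real.exp_pos _).le h1).mul_left _)

/-- The geometric bound equals `1 / (exp (ct) - 1)`, and `exp x - 1 ≥ x`. -/
lemma theta_le_inv {c t : ℝ} (hc : 0 < c) (ht : 0 < t) : theta c t ≤ (c * t)⁻¹ := by
  refine (theta_le hc ht).trans ?_
  have h1 := exp_neg_mul_lt_one hc ht
  have h0 : 0 < c * t := mul_pos hc ht
  have h2 := Real.add_one_le_exp (c * t)
  have h3 : Real.exp (-c * t) * Real.exp (c * t) = 1 := by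
    rw [← Real.exp_add]; simp
  rw [← div_eq_mul_inv, inv_eq_one_div, div_le_div_iff₀ (by linarith) h0]
  nlinarith [Real.exp_pos (-c * t)]

lemma tsum_int_exp_neg_mul_sq {c : ℝ} (hc : 0 < c) :
    ∑' n : ℤ, Real.exp (-c * (n : ℝ) ^ 2) = 1 + 2 * theta c 1 := by
  have hs := summable_theta hc one_pos
  have e1 : (fun n : ℕ => Real.exp (-c * ((n + 1 : ℤ) : ℝ) ^ 2)) =
      fun n : ℕ => Real.exp (-(c * ((n : ℝ) + 1) ^ 2) * 1) := by
    ext n; push_cast; congr 1; ring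
  have e2 : (fun n : ℕ => Real.exp (-c * ((-(n + 1) : ℤ) : ℝ) ^ 2)) =
      fun n : ℕ => Real.exp (-(c * ((n : ℝ) + 1) ^ 2) * 1) := by
    ext n; push_cast; congr 1; ring
  rw [tsum_of_add_one_of_neg_add_one (f := fun n : ℤ => Real.exp (-c * (n : ℝ) ^ 2))
    (by simpa only [e1] using hs) (by simpa only [e2] using hs), e1, e2]
  simp only [theta, Int.cast_zero]
  norm_num
  ring

lemma theta_eq_theta_mul_one (c t : ℝ) : theta c t = theta (c * t) 1 := by
  unfold theta
  congr 1; ext n; congr 1; ring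

/-- Poisson summation for the one-dimensional heat trace. -/
lemma theta_functional {c t : ℝ} (hc : 0 < c) (ht : 0 < t) :
    theta c t = √(Real.pi / c) * (√t)⁻¹ / 2 - 1 / 2 +
      √(Real.pi / c) * (√t)⁻¹ * theta (Real.pi ^ 2 / c) t⁻¹ := by
  have hpi := Real.pi_pos
  have hct : 0 < c * t := mul_pos hc ht
  have h := Real.tsum_exp_neg_mul_int_sq (a := c * t / Real.pi) (by positivity)
  have e1 : -Real.pi * (c * t / Real.pi) = -(c * t) := by field_simp
  have e2 : -Real.pi / (c * t / Real.pi) = -(Real.pi ^ 2 / c * t⁻¹) := by field_simp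
  rw [e1, e2, tsum_int_exp_neg_mul_sq hct, tsum_int_exp_neg_mul_sq (by positivity),
    ← theta_eq_theta_mul_one, ← theta_eq_theta_mul_one, ← Real.sqrt_eq_rpow] at h
  have e3 : 1 / √(c * t / Real.pi) = √(Real.pi / c) * (√t)⁻¹ := by
    rw [← Real.sqrt_inv, ← Real.sqrt_mul (by positivity), one_div, ← Real.sqrt_inv]
    congr 1
    field_simp
  rw [e3] at h
  linarith

lemma continuousOn_theta {c : ℝ} (hc : 0 < c) : ContinuousOn (theta c) (Ioi 0) := by
  intro t ht
  have ht' : 0 < t := ht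
  -- The series converges uniformly away from `0`: it is dominated by its values at `t / 2`.
  have h : ContinuousOn (theta c) (Ioi (t / 2)) := by
    refine continuousOn_tsum (u := fun n : ℕ => Real.exp (-(c * ((n : ℝ) + 1) ^ 2) * (t / 2)))
      (fun n => by fun_prop) (summable_theta hc (half_pos ht')) fun n x hx => ?_
    rw [Real.norm_of_nonneg (Real.exp_pos _).le, Real.exp_le_exp]
    have : 0 ≤ c * ((n : ℝ) + 1) ^ 2 := by positivity
    have hx' : t / 2 < x := hx
    nlinarith
  exact (h.continuousAt (Ioi_mem_nhds (by linarith))).continuousWithinAt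

/-! ### Convergence of Mellin transforms of heat traces -/

/-- The Mellin transform of a sum of exponentials converges wherever the associated Dirichlet
series does: its value at the real part of `s` is a nonzero sum of positive terms. -/
lemma mellinConvergent_of_summable {ι : Type*} [Countable ι] [Nonempty ι] {p : ι → ℝ}
    {F : ℝ → ℝ} {s : ℂ} (hp : ∀ i, 0 < p i) (hs : 0 < s.re)
    (hF : ∀ t ∈ Ioi (0 : ℝ), HasSum (fun i => Real.exp (-p i * t)) (F t))
    (hc : ContinuousOn F (Ioi 0)) (h_sum : Summable fun i => 1 / (p i) ^ s.re) :
    MellinConvergent (fun t => (F t : ℂ)) s := by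
  have hF' : ∀ t ∈ Ioi (0 : ℝ),
      HasSum (fun i => (1 : ℂ) * (Real.exp (-p i * t) : ℂ)) (F t : ℂ) := fun t ht => by
    simpa using Complex.hasSum_ofReal.2 (hF t ht)
  have h := hasSum_mellin (a := fun _ => 1) (p := p) (s := (s.re : ℂ)) (fun i => Or.inr (hp i))
    (by simpa using hs) hF' (by simpa using h_sum)
  have hm : AEStronglyMeasurable (fun t => (F t : ℂ)) (volume.restrict (Ioi 0)) :=
    (Complex.continuous_ofReal.comp_continuousOn hc).aestronglyMeasurable measurableSet_Ioi
  have hreal : MellinConvergent (fun t => (F t : ℂ)) (s.re : ℂ) := by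
    -- A divergent Mellin integral has the default value `0`, whereas the termwise sum at the real
    -- point consists of positive terms.
    by_contra hn
    have h0 : mellin (fun t => (F t : ℂ)) (s.re : ℂ) = 0 := integral_undef hn
    rw [h0] at h
    have e : (fun i => Complex.Gamma (s.re : ℂ) * 1 / (p i : ℂ) ^ (s.re : ℂ)) =
        fun i => ((Real.Gamma s.re / p i ^ s.re : ℝ) : ℂ) := by
      ext i
      rw [Complex.Gamma_ofReal, mul_one, ← Complex.ofReal_cpow (hp i).le]
      push_cast
      rfl
    rw [e, ← Complex.ofReal_zero, Complex.hasSum_ofReal] at h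
    have hpos : ∀ i, 0 < Real.Gamma s.re / p i ^ s.re := fun i =>
      div_pos (Real.Gamma_pos_of_pos hs) (Real.rpow_pos_of_pos (hp i) _)
    have := (hasSum_zero_iff_of_nonneg fun i => (hpos i).le).1 h
    obtain ⟨i⟩ := ‹Nonempty ι›
    exact (hpos i).ne' (congrFun this i)
  have := (mellin_convergent_iff_norm subset_rfl measurableSet_Ioi hm).1 hreal
  refine (mellin_convergent_iff_norm subset_rfl measurableSet_Ioi hm).2 ?_
  simpa using this

lemma summable_one_div_nat_sq_rpow {σ : ℝ} (hσ : 1 / 2 < σ) :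
    Summable fun n : ℕ => 1 / (((n : ℝ) + 1) ^ 2) ^ σ := by
  have h := (summable_nat_add_iff 1).2 (Real.summable_one_div_nat_rpow.2
    (show 1 < 2 * σ by linarith))
  refine h.congr fun n => ?_
  rw [Real.rpow_mul (by positivity)]
  norm_num

lemma mellinConvergent_theta {c : ℝ} (hc : 0 < c) {s : ℂ} (hs : 1 / 2 < s.re) :
    MellinConvergent (fun t => (theta c t : ℂ)) s := by
  refine mellinConvergent_of_summable (p := fun n : ℕ => c * ((n : ℝ) + 1) ^ 2)
    (fun n => by positivity) (by linarith) (fun t ht => hasSum_theta hc ht)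
    (continuousOn_theta hc) ?_
  refine ((summable_one_div_nat_sq_rpow hs).mul_left (1 / c ^ s.re)).congr fun n => ?_
  rw [Real.mul_rpow hc.le (by positivity)]
  field_simp

lemma mellin_theta {c : ℝ} (hc : 0 < c) {s : ℂ} (hs : 1 / 2 < s.re) :
    mellin (fun t => (theta c t : ℂ)) s =
      Complex.Gamma s * (c : ℂ) ^ (-s) * riemannZeta (2 * s) := by
  have hsum : Summable fun n : ℕ => 1 / (c * ((n : ℝ) + 1) ^ 2) ^ s.re := by
    refine ((summable_one_div_nat_sq_rpow hs).mul_left (1 / c ^ s.re)).congr fun n => ?_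
    rw [Real.mul_rpow hc.le (by positivity)]
    field_simp
  have h := hasSum_mellin (a := fun _ : ℕ => (1 : ℂ)) (s := s)
    (p := fun n : ℕ => c * ((n : ℝ) + 1) ^ 2)
    (F := fun t => (theta c t : ℂ)) (fun n => Or.inr (by positivity)) (by linarith)
    (fun t ht => by simpa using Complex.hasSum_ofReal.2 (hasSum_theta hc ht)) (by simpa using hsum)
  rw [← h.tsum_eq, zeta_eq_tsum_one_div_nat_add_one_cpow (by simp; linarith), ← tsum_mul_left]
  congr 1
  ext n
  have e : ((c * ((n : ℝ) + 1) ^ 2 : ℝ) : ℂ) ^ s = (c : ℂ) ^ s * ((n : ℂ) + 1) ^ (2 * s) := by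
    have hn : (0 : ℝ) ≤ (n : ℝ) + 1 := by positivity
    rw [Complex.ofReal_mul, Complex.mul_cpow_ofReal_nonneg hc.le (by positivity)]
    congr 1
    have := Complex.natCast_mul_natCast_cpow (n + 1) (n + 1) s
    have h2 : 2 * s = s + s := by ring
    rw [h2, Complex.cpow_add _ _ (by exact_mod_cast n.succ_ne_zero)]
    push_cast at this ⊢
    rw [← this, sq]
  rw [e, Complex.cpow_neg]
  field_simp

/-! ### The exponentially small part of the heat trace -/

/-- The heat trace of the rectangle, minus its singular part at `t = 0`. -/
def heatRemainder (A B t : ℝ) : ℝ :=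
  theta A t * (√(Real.pi / B) * (√t)⁻¹ * theta (Real.pi ^ 2 / B) t⁻¹)

lemma continuousOn_heatRemainder {A B : ℝ} (hA : 0 < A) (hB : 0 < B) :
    ContinuousOn (heatRemainder A B) (Ioi 0) := by
  have hc : 0 < Real.pi ^ 2 / B := by positivity
  have h0 : ∀ t ∈ Ioi (0 : ℝ), t ≠ 0 := fun t ht => ne_of_gt ht
  have h1 : ContinuousOn (fun t : ℝ => t⁻¹) (Ioi 0) := continuousOn_inv₀.mono fun t ht => h0 t ht
  refine (continuousOn_theta hA).mul ((continuousOn_const.mul ?_).mul ?_)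
  · exact Real.continuous_sqrt.continuousOn.inv₀ fun t ht => (Real.sqrt_pos.2 ht).ne'
  · exact (continuousOn_theta hc).comp h1 fun t ht => mem_Ioi.2 (inv_pos.2 ht)

lemma theta_isBigO_exp {c : ℝ} (hc : 0 < c) :
    theta c =O[atTop] fun t => Real.exp (-c * t) := by
  refine IsBigO.of_bound (1 - Real.exp (-c * 1))⁻¹ ?_
  filter_upwards [eventually_ge_atTop 1] with t ht
  have ht0 : 0 < t := by linarith
  rw [Real.norm_of_nonneg (theta_nonneg _ _), Real.norm_of_nonneg (Real.exp_pos _).le, mul_comm]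
  refine (theta_le hc ht0).trans ?_
  have h1 := exp_neg_mul_lt_one hc one_pos
  refine mul_le_mul_of_nonneg_left (inv_anti₀ (by linarith) ?_) (Real.exp_pos _).le
  have : Real.exp (-c * t) ≤ Real.exp (-c * 1) := Real.exp_le_exp.2 (by nlinarith)
  linarith

lemma theta_isBigO_inv {c : ℝ} (hc : 0 < c) (l : Filter ℝ) (hl : l ≤ 𝓟 (Ioi 0)) :
    theta c =O[l] fun t => t⁻¹ := by
  refine IsBigO.of_bound c⁻¹ ?_
  filter_upwards [hl (mem_principal_self _)] with t ht
  have ht0 : 0 < t := ht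
  rw [Real.norm_of_nonneg (theta_nonneg _ _), Real.norm_of_nonneg (by positivity), ← mul_inv]
  exact theta_le_inv hc ht0

/-- For large `t` the factor `theta A t` decays exponentially and the other theta factor grows at
most linearly; near `0` the two exchange roles. Decay faster than any power at both ends makes the
Mellin transform entire. -/
lemma heatRemainder_isBigO_atTop {A B : ℝ} (hA : 0 < A) (hB : 0 < B) (a : ℝ) :
    heatRemainder A B =O[atTop] fun t => t ^ (-a) := by
  have hc : 0 < Real.pi ^ 2 / B := by positivity
  have h1 : (theta A) =O[atTop] fun t => t ^ (-a - 1) :=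
    (theta_isBigO_exp hA).trans (isLittleO_exp_neg_mul_rpow_atTop hA _).isBigO
  have h2 : (fun t => √(Real.pi / B) * (√t)⁻¹) =O[atTop] fun _ => (1 : ℝ) := by
    refine IsBigO.of_bound (√(Real.pi / B)) ?_
    filter_upwards [eventually_ge_atTop 1] with t ht
    have : (√t)⁻¹ ≤ 1 := inv_le_one_of_one_le₀ (Real.one_le_sqrt.2 ht)
    rw [Real.norm_of_nonneg (by positivity), norm_one]
    gcongr
  have h3 : (fun t => theta (Real.pi ^ 2 / B) t⁻¹) =O[atTop] fun t => t := by
    have := (theta_isBigO_inv hc (𝓝[>] 0) inf_le_right).comp_tendsto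
      tendsto_inv_atTop_nhdsGT_zero
    exact this.congr (fun _ => rfl) fun t => by simp
  refine (h1.mul (h2.mul h3)).congr' EventuallyEq.rfl ?_
  filter_upwards [eventually_gt_atTop 0] with t ht
  rw [one_mul, Real.rpow_sub_one ht.ne']
  field_simp

lemma heatRemainder_isBigO_zero {A B : ℝ} (hA : 0 < A) (hB : 0 < B) (b : ℝ) :
    heatRemainder A B =O[𝓝[>] 0] fun t => t ^ (-b) := by
  have hc : 0 < Real.pi ^ 2 / B := by positivity
  have h1 : theta A =O[𝓝[>] 0] fun t => t⁻¹ := theta_isBigO_inv hA _ inf_le_right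
  have h2 : (fun t => √(Real.pi / B) * (√t)⁻¹) =O[𝓝[>] 0] fun t => t⁻¹ := by
    refine IsBigO.of_bound (√(Real.pi / B)) ?_
    filter_upwards [Ioo_mem_nhdsGT one_pos] with t ht
    have ht0 : 0 < t := ht.1
    have : (√t)⁻¹ ≤ t⁻¹ := by
      refine inv_anti₀ ht0 (Real.le_sqrt_of_sq_le ?_)
      nlinarith [ht.2]
    rw [Real.norm_of_nonneg (by positivity), Real.norm_of_nonneg (by positivity)]
    gcongr
  -- The exponent `b - 2` leaves room for the two factors `t⁻¹` from `h1` and `h2`.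
  have h3 : (fun t => theta (Real.pi ^ 2 / B) t⁻¹) =O[𝓝[>] 0] fun t => t⁻¹ ^ (b - 2) :=
    ((theta_isBigO_exp hc).trans (isLittleO_exp_neg_mul_rpow_atTop hc _).isBigO).comp_tendsto
      tendsto_inv_nhdsGT_zero
  refine (h1.mul (h2.mul h3)).congr' EventuallyEq.rfl ?_
  filter_upwards [self_mem_nhdsWithin] with t ht
  have ht0 : (0 : ℝ) < t := ht
  rw [Real.rpow_sub (inv_pos.2 ht0), Real.rpow_neg ht0.le, Real.inv_rpow ht0.le]
  norm_num
  field_simp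

/-- The Mellin transform of the exponentially small part of the heat trace. -/
def remainderMellin (A B : ℝ) (s : ℂ) : ℂ := mellin (fun t => (heatRemainder A B t : ℂ)) s

lemma locallyIntegrableOn_heatRemainder {A B : ℝ} (hA : 0 < A) (hB : 0 < B) :
    LocallyIntegrableOn (fun t => (heatRemainder A B t : ℂ)) (Ioi 0) :=
  (Complex.continuous_ofReal.comp_continuousOn
    (continuousOn_heatRemainder hA hB)).locallyIntegrableOn measurableSet_Ioi

lemma mellinConvergent_heatRemainder {A B : ℝ} (hA : 0 < A) (hB : 0 < B) (s : ℂ) :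
    MellinConvergent (fun t => (heatRemainder A B t : ℂ)) s :=
  mellinConvergent_of_isBigO_rpow (a := s.re + 1) (b := s.re - 1)
    (locallyIntegrableOn_heatRemainder hA hB)
    (Complex.isBigO_ofReal_left.2 (heatRemainder_isBigO_atTop hA hB _)) (by linarith)
    (Complex.isBigO_ofReal_left.2 (heatRemainder_isBigO_zero hA hB _)) (by linarith)

lemma differentiable_remainderMellin {A B : ℝ} (hA : 0 < A) (hB : 0 < B) :
    Differentiable ℂ (remainderMellin A B) := fun s =>
  mellin_differentiableAt_of_isBigO_rpow (a := s.re + 1) (b := s.re - 1)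
    (locallyIntegrableOn_heatRemainder hA hB)
    (Complex.isBigO_ofReal_left.2 (heatRemainder_isBigO_atTop hA hB _)) (by linarith)
    (Complex.isBigO_ofReal_left.2 (heatRemainder_isBigO_zero hA hB _)) (by linarith)

/-! ### The double series `∑ exp (-2π m k r) / k` -/

/-- The terms of the double series `∑ exp (-2π m k r) / k` over positive integers `m`, `k`. -/
def lambertTerm (r : ℝ) (p : ℕ × ℕ) : ℝ :=
  ((p.2 : ℝ) + 1)⁻¹ * Real.exp (-(2 * Real.pi * ((p.1 : ℝ) + 1) * ((p.2 : ℝ) + 1) * r))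

/-- The double series `∑ exp (-2π m k r) / k` over positive integers `m`, `k`. -/
def lambertSum (r : ℝ) : ℝ := ∑' p : ℕ × ℕ, lambertTerm r p

lemma lambertTerm_pos (r : ℝ) (p : ℕ × ℕ) : 0 < lambertTerm r p := by
  unfold lambertTerm; positivity

lemma summable_lambertTerm {r : ℝ} (hr : 0 < r) : Summable (lambertTerm r) := by
  have hpi := Real.pi_pos
  set q := Real.exp (-(2 * Real.pi * r)) with hq
  have hq1 : q < 1 := by rw [hq, Real.exp_lt_one_iff]; nlinarith [mul_pos hpi hr]
  have hg := summable_geometric_of_lt_one (Real.exp_pos _).le hq1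
  refine Summable.of_nonneg_of_le (fun p => (lambertTerm_pos r p).le) (fun p => ?_)
    (hg.mul_of_nonneg hg (fun _ => by positivity) fun _ => by positivity)
  have h1 : ((p.2 : ℝ) + 1)⁻¹ ≤ 1 := inv_le_one_of_one_le₀ (by simp)
  have h2 : Real.exp (-(2 * Real.pi * ((p.1 : ℝ) + 1) * ((p.2 : ℝ) + 1) * r)) ≤
      q ^ p.1 * q ^ p.2 := by
    rw [hq, ← Real.exp_nat_mul, ← Real.exp_nat_mul, ← Real.exp_add, Real.exp_le_exp]
    have h : (0 : ℝ) ≤ p.1 * p.2 + 1 := by positivity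
    have := mul_nonneg (mul_pos hpi hr).le h
    nlinarith
  calc lambertTerm r p ≤ 1 * (q ^ p.1 * q ^ p.2) :=
        mul_le_mul h1 h2 (Real.exp_pos _).le zero_le_one
    _ = _ := one_mul _

lemma lambertSum_nonneg (r : ℝ) : 0 ≤ lambertSum r := tsum_nonneg fun p => (lambertTerm_pos r p).le

/-- Each term is a positive multiple of the exponential of a linear function of `r`. -/
lemma convexOn_lambertSum : ConvexOn ℝ (Ioi 0) lambertSum := by
  refine ⟨convex_Ioi 0, fun x hx y hy a b ha hb hab => ?_⟩
  have hz : a • x + b • y ∈ Ioi (0 : ℝ) := convex_Ioi 0 hx hy ha hb hab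
  have hs := ((summable_lambertTerm hx).mul_left a).add ((summable_lambertTerm hy).mul_left b)
  simp only [lambertSum, smul_eq_mul]
  rw [← tsum_mul_left, ← tsum_mul_left, ← ((summable_lambertTerm hx).mul_left a).tsum_add
    ((summable_lambertTerm hy).mul_left b)]
  refine Summable.tsum_le_tsum (fun p => ?_) (summable_lambertTerm hz) hs
  have h := convexOn_exp.2 (mem_univ (-(2 * Real.pi * ((p.1 : ℝ) + 1) * ((p.2 : ℝ) + 1) * x)))
    (mem_univ (-(2 * Real.pi * ((p.1 : ℝ) + 1) * ((p.2 : ℝ) + 1) * y))) ha hb hab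
  have e : a • (-(2 * Real.pi * ((p.1 : ℝ) + 1) * ((p.2 : ℝ) + 1) * x)) +
      b • (-(2 * Real.pi * ((p.1 : ℝ) + 1) * ((p.2 : ℝ) + 1) * y)) =
      -(2 * Real.pi * ((p.1 : ℝ) + 1) * ((p.2 : ℝ) + 1) * (a * x + b * y)) := by
    simp only [smul_eq_mul]; ring
  rw [e] at h
  simp only [smul_eq_mul] at h
  have hk : 0 ≤ ((p.2 : ℝ) + 1)⁻¹ := by positivity
  have := mul_le_mul_of_nonneg_left h hk
  simp only [lambertTerm]
  linarith

/-- At `s = 0` the measure is `dt/t`, and each pair of terms of the two theta series gives the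
integral above with `a = √A m` and `b = πk/√B`. Then `2ab = 2πmk √(A/B)`, and the prefactor `√(π/B)
√π / b` is `1/k`. Positivity of the terms justifies the interchange. -/
lemma remainderMellin_zero {A B : ℝ} (hA : 0 < A) (hB : 0 < B) :
    remainderMellin A B 0 = (lambertSum √(A / B) : ℂ) := by
  have hpi := Real.pi_pos
  have hc : 0 < Real.pi ^ 2 / B := by positivity
  have hsA : 0 < √A := Real.sqrt_pos.2 hA
  have hsB : 0 < √B := Real.sqrt_pos.2 hB
  have hsP : 0 < √Real.pi := Real.sqrt_pos.2 hpi
  set a : ℕ × ℕ → ℝ := fun p => √A * ((p.1 : ℝ) + 1) with ha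
  set b : ℕ × ℕ → ℝ := fun p => Real.pi / √B * ((p.2 : ℝ) + 1) with hb
  set f : ℕ × ℕ → ℝ → ℝ := fun p t => √(Real.pi / B) *
    (t⁻¹ * (√t)⁻¹ * Real.exp (-(a p ^ 2 * t) - b p ^ 2 * t⁻¹)) with hf
  have hI := fun p : ℕ × ℕ => integral_inv_mul_inv_sqrt_mul_exp
    (show 0 < a p by simp only [ha]; positivity) (show 0 < b p by simp only [hb]; positivity)
  have hfi : ∀ p, IntegrableOn (f p) (Ioi 0) := fun p => (hI p).1.const_mul _
  have hfv : ∀ p, ∫ t in Ioi (0 : ℝ), f p t = lambertTerm √(A / B) p := fun p => by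
    simp only [hf]
    rw [integral_const_mul, (hI p).2, Real.sqrt_div hpi.le, Real.sqrt_div hA.le]
    have e : Real.exp (-(2 * a p * b p)) =
        Real.exp (-(2 * Real.pi * ((p.1 : ℝ) + 1) * ((p.2 : ℝ) + 1) * (√A / √B))) := by
      congr 1; simp only [ha, hb]; ring
    rw [e, lambertTerm, ← mul_assoc]
    congr 1
    simp only [hb]
    field_simp
    exact Real.sq_sqrt hpi.le
  have hnorm : ∀ p, ∫ t in Ioi (0 : ℝ), ‖f p t‖ = lambertTerm √(A / B) p := fun p => by
    rw [← hfv p]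
    refine setIntegral_congr_fun measurableSet_Ioi fun t ht => Real.norm_of_nonneg ?_
    have ht0 : (0 : ℝ) < t := ht
    simp only [hf]
    positivity
  have hsum := hasSum_integral_of_summable_integral_norm hfi
    (by simpa only [hnorm] using summable_lambertTerm (Real.sqrt_pos.2 (div_pos hA hB)))
  simp only [hfv] at hsum
  have hW : ∀ t ∈ Ioi (0 : ℝ), ∑' p, f p t = t⁻¹ * heatRemainder A B t := fun t ht => by
    have ht0 : (0 : ℝ) < t := ht
    have hm := hasSum_theta hA ht0
    have hk := hasSum_theta hc (inv_pos.2 ht0)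
    have hp := (hm.mul hk (hm.summable.mul_of_nonneg hk.summable (fun _ => (Real.exp_pos _).le)
      fun _ => (Real.exp_pos _).le)).mul_left (t⁻¹ * (√(Real.pi / B) * (√t)⁻¹))
    have e : t⁻¹ * heatRemainder A B t =
        t⁻¹ * (√(Real.pi / B) * (√t)⁻¹) * (theta A t * theta (Real.pi ^ 2 / B) t⁻¹) := by
      simp only [heatRemainder]; ring
    rw [e, ← hp.tsum_eq]
    congr 1
    ext p
    have e2 : Real.exp (-(a p ^ 2 * t) - b p ^ 2 * t⁻¹) =
        Real.exp (-(A * ((p.1 : ℝ) + 1) ^ 2) * t) *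
          Real.exp (-(Real.pi ^ 2 / B * ((p.2 : ℝ) + 1) ^ 2) * t⁻¹) := by
      rw [← Real.exp_add]
      congr 1
      simp only [ha, hb, mul_pow, div_pow, Real.sq_sqrt hA.le, Real.sq_sqrt hB.le]
      ring
    simp only [hf, e2]
    ring
  have hint : ∫ t in Ioi (0 : ℝ), t⁻¹ * heatRemainder A B t = lambertSum √(A / B) := by
    rw [← setIntegral_congr_fun measurableSet_Ioi hW]
    exact hsum.tsum_eq.symm
  rw [remainderMellin, mellin, ← hint, ← integral_complex_ofReal]
  refine setIntegral_congr_fun measurableSet_Ioi fun t ht => ?_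
  simp only [zero_sub, Complex.cpow_neg_one, smul_eq_mul]
  push_cast
  rfl

/-! ### The two-dimensional zeta function -/

/-- The meromorphic continuation of `∑ (A m² + B n²) ^ (-s)` over positive integers `m`, `n`. -/
def rectZeta (A B : ℝ) (s : ℂ) : ℂ :=
  -(1 / 2) * ((A : ℂ) ^ (-s) * riemannZeta (2 * s)) +
    ((√(Real.pi / B) / 2 : ℝ) * (Complex.Gamma (s - 1 / 2) * (A : ℂ) ^ (-(s - 1 / 2)) *
      riemannZeta (2 * (s - 1 / 2))) + remainderMellin A B s) * (Complex.Gamma s)⁻¹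

lemma summable_rect {A B σ : ℝ} (hA : 0 < A) (hB : 0 < B) (hσ : 1 < σ) :
    Summable fun p : ℕ × ℕ => 1 / (A * ((p.1 : ℝ) + 1) ^ 2 + B * ((p.2 : ℝ) + 1) ^ 2) ^ σ := by
  have h : Summable fun n : ℕ => 1 / ((n : ℝ) + 1) ^ σ := by
    simpa using (summable_nat_add_iff 1).2 (Real.summable_one_div_nat_rpow.2 hσ)
  have h2 := (h.mul_of_nonneg h (fun _ => by positivity) fun _ => by positivity).mul_left
    (1 / (2 * (√A * √B)) ^ σ)
  refine Summable.of_nonneg_of_le (fun p => by positivity) (fun p => ?_) h2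
  have hsA : 0 < √A := Real.sqrt_pos.2 hA
  have hsB : 0 < √B := Real.sqrt_pos.2 hB
  -- The inequality of arithmetic and geometric means bounds the double series by a product of two
  -- convergent ones.
  have key : 2 * (√A * √B) * (((p.1 : ℝ) + 1) * ((p.2 : ℝ) + 1)) ≤
      A * ((p.1 : ℝ) + 1) ^ 2 + B * ((p.2 : ℝ) + 1) ^ 2 := by
    have := sq_nonneg (√A * ((p.1 : ℝ) + 1) - √B * ((p.2 : ℝ) + 1))
    have h3 := Real.sq_sqrt hA.le
    have h4 := Real.sq_sqrt hB.le
    calc _ ≤ √A ^ 2 * ((p.1 : ℝ) + 1) ^ 2 + √B ^ 2 * ((p.2 : ℝ) + 1) ^ 2 := by nlinarith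
      _ = _ := by rw [h3, h4]
  rw [one_div_mul_one_div, one_div_mul_one_div,
    ← Real.mul_rpow (by positivity) (by positivity), ← Real.mul_rpow (by positivity) (by positivity)]
  refine one_div_le_one_div_of_le (by positivity) ?_
  exact Real.rpow_le_rpow (by positivity) key (by linarith)

lemma hasSum_theta_mul_theta {A B t : ℝ} (hA : 0 < A) (hB : 0 < B) (ht : 0 < t) :
    HasSum (fun p : ℕ × ℕ =>
      Real.exp (-(A * ((p.1 : ℝ) + 1) ^ 2 + B * ((p.2 : ℝ) + 1) ^ 2) * t))
      (theta A t * theta B t) := by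
  have hm := hasSum_theta hA ht
  have hk := hasSum_theta hB ht
  refine (hm.mul hk (hm.summable.mul_of_nonneg hk.summable (fun _ => (Real.exp_pos _).le)
      fun _ => (Real.exp_pos _).le)).congr_fun ?_
  intro p
  rw [← Real.exp_add]
  congr 1
  ring

/-- The Mellin transform is evaluated in two ways: termwise, and after Poisson summation in `theta
B`. The factor `t ^ (-1/2)` shifts `s` by `1/2`, so convergence of the shifted transform requires
exactly `Re s > 1`. -/
lemma hasSum_rectZeta {A B : ℝ} (hA : 0 < A) (hB : 0 < B) {s : ℂ} (hs : 1 < s.re) :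
    HasSum (fun p : ℕ × ℕ =>
      ((A * ((p.1 : ℝ) + 1) ^ 2 + B * ((p.2 : ℝ) + 1) ^ 2 : ℝ) : ℂ) ^ (-s)) (rectZeta A B s) := by
  have h := hasSum_mellin (a := fun _ : ℕ × ℕ => (1 : ℂ)) (s := s)
    (p := fun p : ℕ × ℕ => A * ((p.1 : ℝ) + 1) ^ 2 + B * ((p.2 : ℝ) + 1) ^ 2)
    (F := fun t => ((theta A t * theta B t : ℝ) : ℂ)) (fun n => Or.inr (by positivity))
    (by linarith)
    (fun t ht => by simpa only [one_mul] using
      Complex.hasSum_ofReal.2 (hasSum_theta_mul_theta hA hB ht))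
    (by simpa only [norm_one] using summable_rect hA hB hs)
  have hG : Complex.Gamma s ≠ 0 := Complex.Gamma_ne_zero_of_re_pos (by linarith)
  have hre : (s - 1 / 2).re = s.re - 1 / 2 := by simp
  have c1 : MellinConvergent (fun t : ℝ => (t : ℂ) ^ (-(1 / 2) : ℂ) • (theta A t : ℂ)) s := by
    rw [MellinConvergent.cpow_smul]
    exact mellinConvergent_theta hA (by rw [← sub_eq_add_neg, hre]; linarith)
  have c2 := mellinConvergent_theta hA (show 1 / 2 < s.re by linarith)
  have hM1 := hasMellin_sub (c1.const_smul ((√(Real.pi / B) / 2 : ℝ) : ℂ))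
    (c2.const_smul (1 / 2 : ℂ))
  have hM := (hasMellin_add hM1.1 (mellinConvergent_heatRemainder hA hB s)).2
  rw [hM1.2, mellin_const_smul, mellin_const_smul, mellin_cpow_smul, ← sub_eq_add_neg,
    mellin_theta hA (show 1 / 2 < s.re by linarith),
    mellin_theta hA (show 1 / 2 < (s - 1 / 2).re by rw [hre]; linarith)] at hM
  have hF : mellin (fun t => ((theta A t * theta B t : ℝ) : ℂ)) s = rectZeta A B s *
      Complex.Gamma s := by
    rw [rectZeta, add_mul, mul_assoc (_ + _), inv_mul_cancel₀ hG, mul_one, remainderMellin]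
    refine Eq.trans ?_ (hM.trans ?_)
    · refine setIntegral_congr_fun measurableSet_Ioi fun t ht => ?_
      have ht0 : (0 : ℝ) < t := ht
      have e : ((theta A t * theta B t : ℝ) : ℂ) =
          ((√(Real.pi / B) / 2 : ℝ) : ℂ) • (t : ℂ) ^ (-(1 / 2) : ℂ) • (theta A t : ℂ) -
            (1 / 2 : ℂ) • (theta A t : ℂ) + (heatRemainder A B t : ℂ) := by
        have e1 : (t : ℂ) ^ (-(1 / 2) : ℂ) = (((√t)⁻¹ : ℝ) : ℂ) := by
          rw [Real.sqrt_eq_rpow, ← Real.rpow_neg ht0.le, Complex.ofReal_cpow ht0.le]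
          push_cast
          rfl
        rw [e1, theta_functional hB ht0, heatRemainder]
        simp only [smul_eq_mul]
        push_cast
        ring
      simp only [e]
    · simp only [smul_eq_mul]
      ring
  have h3 := h.mul_left (Complex.Gamma s)⁻¹
  rw [hF, mul_comm (rectZeta A B s), inv_mul_cancel_left₀ hG] at h3
  refine h3.congr_fun fun p => ?_
  rw [Complex.cpow_neg, mul_one, div_eq_mul_inv, inv_mul_cancel_left₀ hG]

lemma meromorphicAt_riemannZeta (s : ℂ) : MeromorphicAt riemannZeta s := by
  have h : MeromorphicAt (fun s : ℂ => (s - 1)⁻¹ + riemannZeta₀ s) s :=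
    ((AnalyticAt.meromorphicAt (by fun_prop)).inv).add
      (differentiable_riemannZeta₀.analyticAt s).meromorphicAt
  refine h.congr ?_
  have h1 : ∀ᶠ z in 𝓝[≠] s, z ≠ 1 := by
    rcases eq_or_ne s 1 with rfl | hs
    · exact self_mem_nhdsWithin
    · exact nhdsWithin_le_nhds (isOpen_ne.mem_nhds hs)
  filter_upwards [h1] with z hz using (riemannZeta_eq_inv_sub_add hz).symm

lemma differentiable_ofReal_cpow_comp {A : ℝ} (hA : 0 < A) {g : ℂ → ℂ} (hg : Differentiable ℂ g) :
    Differentiable ℂ fun s => (A : ℂ) ^ g s := fun s =>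
  (hg s).const_cpow (Or.inl (by exact_mod_cast hA.ne'))

lemma differentiable_inv_Gamma : Differentiable ℂ fun s => (Complex.Gamma s)⁻¹ := by
  simpa using Complex.differentiable_one_div_Gamma

/-- `1/Γ` vanishes at `0` with derivative `1`, so the derivative of `g` does not enter. -/
lemma hasDerivAt_mul_inv_Gamma_zero {g : ℂ → ℂ} (hg : DifferentiableAt ℂ g 0) :
    HasDerivAt (fun s => g s * (Complex.Gamma s)⁻¹) (g 0) 0 := by
  have e : (fun s => (Complex.Gamma s)⁻¹) = fun s => s * (Complex.Gamma (s + 1))⁻¹ := by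
    ext s
    simpa using Complex.one_div_Gamma_eq_self_mul_one_div_Gamma_add_one s
  have h1 : DifferentiableAt ℂ (fun s => (Complex.Gamma (s + 1))⁻¹) 0 :=
    (differentiable_inv_Gamma.comp (differentiable_id.add_const 1)) 0
  have h2 : HasDerivAt (fun s => (Complex.Gamma s)⁻¹) 1 0 := by
    rw [e]
    refine ((hasDerivAt_id (0 : ℂ)).mul h1.hasDerivAt).congr_deriv ?_
    simp
  refine (hg.hasDerivAt.mul h2).congr_deriv ?_
  simp

lemma Gamma_neg_half : Complex.Gamma (-(1 / 2)) = -2 * (√Real.pi : ℝ) := by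
  have h := Complex.Gamma_add_one (-(1 / 2)) (by norm_num)
  rw [show -(1 / 2) + 1 = (1 / 2 : ℂ) by norm_num, Complex.Gamma_one_half_eq] at h
  have e : (Real.pi : ℂ) ^ (1 / 2 : ℂ) = (√Real.pi : ℝ) := by
    rw [Real.sqrt_eq_rpow, Complex.ofReal_cpow Real.pi_pos.le]
    norm_num
  rw [e] at h
  rw [h]
  ring

lemma riemannZeta_neg_one : riemannZeta (-1) = -(1 / 12) := by
  have h := riemannZeta_neg_nat_eq_bernoulli 1
  norm_num [bernoulli_two] at h
  rw [h]

lemma differentiableAt_Gamma_factor {A B : ℝ} (hA : 0 < A) (hB : 0 < B) :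
    DifferentiableAt ℂ (fun s : ℂ => (√(Real.pi / B) / 2 : ℝ) * (Complex.Gamma (s - 1 / 2) *
      (A : ℂ) ^ (-(s - 1 / 2)) * riemannZeta (2 * (s - 1 / 2))) + remainderMellin A B s) 0 := by
  have h1 : DifferentiableAt ℂ (fun s : ℂ => Complex.Gamma (s - 1 / 2)) 0 := by
    refine DifferentiableAt.comp (0 : ℂ) (g := Complex.Gamma) (Complex.differentiableAt_Gamma _
      fun m h => ?_) (by fun_prop)
    have := congrArg Complex.re h
    norm_num at this
    have h2 : (1 : ℝ) = ((2 * m : ℕ) : ℝ) := by push_cast; linarith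
    have h3 : 1 = 2 * m := by exact_mod_cast h2
    omega
  have h2 : DifferentiableAt ℂ (fun s : ℂ => riemannZeta (2 * (s - 1 / 2))) 0 := by
    refine DifferentiableAt.comp (0 : ℂ) (g := riemannZeta) (differentiableAt_riemannZeta ?_)
      (by fun_prop)
    norm_num
  exact (((h1.mul (differentiable_ofReal_cpow_comp hA (by fun_prop) 0)).mul h2).const_mul _).add
    (differentiable_remainderMellin hA hB 0)

/-- The first two terms come from `ζ(0) = -1/2` and `ζ'(0) = -log(2π)/2`; the third from `Γ(-1/2) =
-2√π` and `ζ(-1) = -1/12`. -/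
lemma hasDerivAt_rectZeta_zero {A B : ℝ} (hA : 0 < A) (hB : 0 < B) :
    HasDerivAt (rectZeta A B) ((-Real.log A / 4 + Real.log (2 * Real.pi) / 2 +
      Real.pi / 12 * √(A / B) + lambertSum √(A / B) : ℝ) : ℂ) 0 := by
  have hA' : (A : ℂ) ≠ 0 := by exact_mod_cast hA.ne'
  have d1 : HasDerivAt (fun s : ℂ => (A : ℂ) ^ (-s)) (-(Real.log A : ℂ)) 0 := by
    refine ((hasDerivAt_id (0 : ℂ)).neg.const_cpow (Or.inl hA')).congr_deriv ?_
    simp [Complex.ofReal_log hA.le]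
  have d2 : HasDerivAt (fun s : ℂ => riemannZeta (2 * s)) (-(Real.log (2 * Real.pi) : ℂ)) 0 := by
    have h0 : HasDerivAt riemannZeta (-Complex.log (2 * Real.pi) / 2) (2 * 0) := by
      rw [mul_zero, ← deriv_riemannZeta_zero]
      exact (differentiableAt_riemannZeta zero_ne_one).hasDerivAt
    refine (h0.comp (0 : ℂ) ((hasDerivAt_id (0 : ℂ)).const_mul 2)).congr_deriv ?_
    rw [Complex.ofReal_log (by positivity)]
    push_cast
    ring
  have d3 := hasDerivAt_mul_inv_Gamma_zero (differentiableAt_Gamma_factor hA hB)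
  refine (((d1.mul d2).const_mul (-(1 / 2) : ℂ)).add d3).congr_deriv ?_
  have e1 : (A : ℂ) ^ (-(0 - 1 / 2) : ℂ) = (√A : ℝ) := by
    rw [Real.sqrt_eq_rpow, Complex.ofReal_cpow hA.le]
    norm_num
  have e2 : riemannZeta (2 * (0 - 1 / 2)) = -(1 / 12) := by
    rw [← riemannZeta_neg_one]; norm_num
  have e3 : Complex.Gamma (0 - 1 / 2) = -2 * (√Real.pi : ℝ) := by
    rw [← Gamma_neg_half]; norm_num
  rw [e1, e2, e3, remainderMellin_zero hA hB, mul_zero, riemannZeta_zero, neg_zero,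
    Complex.cpow_zero, Real.sqrt_div Real.pi_pos.le, Real.sqrt_div hA.le]
  have hB' : ((√B : ℝ) : ℂ) ≠ 0 := by exact_mod_cast (Real.sqrt_pos.2 hB).ne'
  have hpi : ((√Real.pi : ℝ) : ℂ) * (√Real.pi : ℝ) = Real.pi := by
    exact_mod_cast Real.mul_self_sqrt Real.pi_pos.le
  push_cast
  rw [← hpi]
  field_simp
  ring

lemma meromorphicAt_rectZeta {A B : ℝ} (hA : 0 < A) (hB : 0 < B) (s : ℂ) :
    MeromorphicAt (rectZeta A B) s := by
  have c1 := ((differentiable_ofReal_cpow_comp hA (g := fun s => -s)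
    (by fun_prop)).analyticAt s).meromorphicAt
  have c2 := ((differentiable_ofReal_cpow_comp hA (g := fun s => -(s - 1 / 2))
    (by fun_prop)).analyticAt s).meromorphicAt
  have z1 : MeromorphicAt (fun s : ℂ => riemannZeta (2 * s)) s :=
    (meromorphicAt_riemannZeta _).comp_analyticAt (by fun_prop)
  have z2 : MeromorphicAt (fun s : ℂ => riemannZeta (2 * (s - 1 / 2))) s :=
    (meromorphicAt_riemannZeta _).comp_analyticAt (g := fun s : ℂ => 2 * (s - 1 / 2)) (by fun_prop)
  have g1 : MeromorphicAt (fun s : ℂ => Complex.Gamma (s - 1 / 2)) s :=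
    (Meromorphic.Gamma _).comp_analyticAt (g := fun s : ℂ => s - 1 / 2) (by fun_prop)
  have g2 := (differentiable_inv_Gamma.analyticAt s).meromorphicAt
  have m := ((differentiable_remainderMellin hA hB).analyticAt s).meromorphicAt
  exact ((MeromorphicAt.const _ s).mul (c1.mul z1)).add
    ((((MeromorphicAt.const _ s).mul ((g1.mul c2).mul z2)).add m).mul g2)

lemma analyticAt_riemannZeta {s : ℂ} (hs : s ≠ 1) : AnalyticAt ℂ riemannZeta s :=
  differentiableOn_riemannZeta.analyticAt (isOpen_compl_singleton.mem_nhds hs)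

lemma analyticAt_rectZeta_zero {A B : ℝ} (hA : 0 < A) (hB : 0 < B) :
    AnalyticAt ℂ (rectZeta A B) 0 := by
  have c1 := (differentiable_ofReal_cpow_comp hA (g := fun s => -s) (by fun_prop)).analyticAt 0
  have c2 := (differentiable_ofReal_cpow_comp hA (g := fun s => -(s - 1 / 2))
    (by fun_prop)).analyticAt 0
  have z1 : AnalyticAt ℂ (fun s : ℂ => riemannZeta (2 * s)) 0 :=
    (analyticAt_riemannZeta (by norm_num)).fun_comp (by fun_prop)
  have z2 : AnalyticAt ℂ (fun s : ℂ => riemannZeta (2 * (s - 1 / 2))) 0 :=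
    (analyticAt_riemannZeta (by norm_num)).fun_comp (f := fun s : ℂ => 2 * (s - 1 / 2))
      (by fun_prop)
  have g1 : AnalyticAt ℂ (fun s : ℂ => Complex.Gamma (s - 1 / 2)) 0 := by
    -- Analyticity of `Γ` at `-1/2` is read off from the entire function `1/Γ`, which does not
    -- vanish there.
    have h0 : Complex.Gamma (0 - 1 / 2) ≠ 0 := by
      rw [zero_sub, Gamma_neg_half]
      have : √Real.pi ≠ 0 := (Real.sqrt_pos.2 Real.pi_pos).ne'
      simpa using this
    have h := ((differentiable_inv_Gamma.analyticAt (0 - 1 / 2)).fun_comp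
      (f := fun s : ℂ => s - 1 / 2) (x := 0) (by fun_prop)).inv (inv_ne_zero h0)
    exact h.congr (.of_forall fun s => by simp)
  have g2 := differentiable_inv_Gamma.analyticAt 0
  have m := (differentiable_remainderMellin hA hB).analyticAt 0
  exact (analyticAt_const.mul (c1.mul z1)).add
    (((analyticAt_const.mul ((g1.mul c2).mul z2)).add m).mul g2)

/-! ### Uniqueness of the continuation -/

/-- Identity theorem: the difference has infinite order at `2`, hence at `0`, since the plane is
connected. Analyticity at `0` extends the equality from a punctured neighbourhood to the point
itself. -/
lemma eventuallyEq_nhds_zero_of_meromorphicOn {Z Z' : ℂ → ℂ} (hZ : MeromorphicOn Z univ)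
    (hZ' : MeromorphicOn Z' univ) (h0 : AnalyticAt ℂ Z 0) (h0' : AnalyticAt ℂ Z' 0)
    (h : ∀ s : ℂ, 1 < s.re → Z s = Z' s) : Z =ᶠ[𝓝 0] Z' := by
  have hd : MeromorphicOn (Z - Z') univ := hZ.sub hZ'
  have h2 : meromorphicOrderAt (Z - Z') 2 = ⊤ := by
    rw [meromorphicOrderAt_eq_top_iff]
    refine nhdsWithin_le_nhds ?_
    have ho : IsOpen {s : ℂ | 1 < s.re} := isOpen_lt continuous_const Complex.continuous_re
    filter_upwards [ho.mem_nhds (show (1 : ℝ) < (2 : ℂ).re by norm_num)] with s hs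
    rw [Pi.sub_apply, h s hs, sub_self]
  have h3 : meromorphicOrderAt (Z - Z') 0 = ⊤ := by
    by_contra hne
    exact hd.meromorphicOrderAt_ne_top_of_isPreconnected isPreconnected_univ (mem_univ 0)
      (mem_univ 2) hne h2
  rw [meromorphicOrderAt_eq_top_iff] at h3
  have h4 : ∀ᶠ z in 𝓝[≠] (0 : ℂ), Z z = Z' z := by
    filter_upwards [h3] with z hz using sub_eq_zero.1 hz
  exact (h0.frequently_eq_iff_eventually_eq h0').1 h4.frequently

lemma IsSpectralZeta.deriv_zero_eq {Ω : Opens Plane} {Z Z' : ℂ → ℂ} (hZ : IsSpectralZeta Ω Z)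
    (hZ' : IsSpectralZeta Ω Z') : deriv Z 0 = deriv Z' 0 :=
  (eventuallyEq_nhds_zero_of_meromorphicOn hZ.meromorphic hZ'.meromorphic hZ.analyticAt_zero
    hZ'.analyticAt_zero fun s hs => (hZ.hasSum s hs).unique (hZ'.hasSum s hs)).deriv_eq

/-- The formula for `rectZeta` is not symmetric, as Poisson summation singles out `B`, but the
double series that it continues is. -/
lemma deriv_rectZeta_swap {A B : ℝ} (hA : 0 < A) (hB : 0 < B) :
    deriv (rectZeta A B) 0 = deriv (rectZeta B A) 0 := by
  refine (eventuallyEq_nhds_zero_of_meromorphicOn (fun s _ => meromorphicAt_rectZeta hA hB s)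
    (fun s _ => meromorphicAt_rectZeta hB hA s) (analyticAt_rectZeta_zero hA hB)
    (analyticAt_rectZeta_zero hB hA) fun s hs => ?_).deriv_eq
  refine (hasSum_rectZeta hA hB hs).unique ?_
  refine ((Equiv.prodComm ℕ ℕ).hasSum_iff.2 (hasSum_rectZeta hB hA hs)).congr_fun fun p => ?_
  simp only [Function.comp_apply, Equiv.prodComm_apply, Prod.fst_swap, Prod.snd_swap]
  rw [add_comm]

/-! ### The logarithm of the determinant -/

/-- Up to an additive constant, the logarithm of the determinant of the Dirichlet Laplacian on a
rectangle with unit area and quotient of sides `r`. -/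
def logDet (r : ℝ) : ℝ := Real.log r / 4 - Real.pi / 12 * r - lambertSum r

/-- This is the transformation law of `|η|` under `z ↦ -1/z` on the imaginary axis, obtained by
comparing the two formulas for the derivative at `0` with `A = r²`, `B = 1` and exchanged. -/
lemma logDet_inv {r : ℝ} (hr : 0 < r) : logDet r⁻¹ = logDet r := by
  have h := deriv_rectZeta_swap (pow_pos hr 2) one_pos
  rw [(hasDerivAt_rectZeta_zero (pow_pos hr 2) one_pos).deriv,
    (hasDerivAt_rectZeta_zero one_pos (pow_pos hr 2)).deriv, Complex.ofReal_inj, div_one,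
    Real.sqrt_sq hr.le, one_div, Real.sqrt_inv, Real.sqrt_sq hr.le, Real.log_one,
    Real.log_pow] at h
  simp only [logDet, Real.log_inv]
  push_cast at h
  linarith

/-- The weights `1/(1+r)` and `r/(1+r)` average `r` and `1/r` to `1`. Strict concavity, coming from
the logarithm, then beats the common value at `r` and `1/r`. -/
lemma logDet_lt_logDet_one {r : ℝ} (hr : 0 < r) (h1 : r ≠ 1) : logDet r < logDet 1 := by
  have hi : 0 < r⁻¹ := inv_pos.2 hr
  have hne : r ≠ r⁻¹ := fun h => h1 (by
    have h2 : r * r = 1 := by nth_rewrite 2 [h]; exact mul_inv_cancel₀ hr.ne'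
    nlinarith)
  have hpos : 0 < 1 + r := by linarith
  have ha : 0 < 1 / (1 + r) := by positivity
  have hb : 0 < r / (1 + r) := by positivity
  have hab : 1 / (1 + r) + r / (1 + r) = 1 := by field_simp
  have hc : (1 / (1 + r)) * r + (r / (1 + r)) * r⁻¹ = 1 := by field_simp; ring
  have hlog := strictConcaveOn_log_Ioi.2 (mem_Ioi.2 hr) (mem_Ioi.2 hi) hne ha hb hab
  have hS := convexOn_lambertSum.2 (mem_Ioi.2 hr) (mem_Ioi.2 hi) ha.le hb.le hab
  simp only [smul_eq_mul, hc] at hlog hS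
  have hsym := logDet_inv hr
  have key : (1 / (1 + r)) * logDet r + (r / (1 + r)) * logDet r⁻¹ < logDet 1 := by
    simp only [logDet]
    have : (1 / (1 + r)) * (Real.pi / 12 * r) + (r / (1 + r)) * (Real.pi / 12 * r⁻¹) =
        Real.pi / 12 * 1 := by
      linear_combination Real.pi / 12 * hc
    linarith
  rwa [hsym, ← add_mul, hab, one_mul] at key

lemma tendsto_logDet_atTop : Tendsto logDet atTop atBot := by
  have h3 := Real.pi_gt_three
  -- From `log r ≤ r - 1`, the logarithmic term is at most `r/4 = 3r/12`, which `πr/12` outgrows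
  -- because `π > 3`.
  have hlin : Tendsto (fun r : ℝ => -((Real.pi - 3) / 12) * r) atTop atBot :=
    tendsto_id.const_mul_atTop_of_neg (by linarith)
  refine tendsto_atBot_mono' _ ?_ hlin
  filter_upwards [eventually_gt_atTop 0] with r hr
  have := Real.log_le_sub_one_of_pos hr
  have := lambertSum_nonneg r
  simp only [logDet]
  linarith

/-! ### The Dedekind eta function on the imaginary axis -/

/-- Summing the double series over `k` first gives the expansion `-log (1 - x) = ∑ x^k / k` at `x =
exp(-2πr)^(m+1)`. -/
lemma hasSum_log_one_sub_exp {r : ℝ} (hr : 0 < r) :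
    HasSum (fun m : ℕ => Real.log (1 - Real.exp (-(2 * Real.pi * r)) ^ (m + 1)))
      (-lambertSum r) := by
  have hpi := Real.pi_pos
  have hq : Real.exp (-(2 * Real.pi * r)) < 1 := by
    rw [Real.exp_lt_one_iff]; nlinarith [mul_pos hpi hr]
  have h := (summable_lambertTerm hr).hasSum.prod_fiberwise
    (g := fun m : ℕ => -Real.log (1 - Real.exp (-(2 * Real.pi * r)) ^ (m + 1))) fun m => by
      have hx : |Real.exp (-(2 * Real.pi * r)) ^ (m + 1)| < 1 := by
        rw [abs_of_pos (by positivity)]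
        exact pow_lt_one₀ (Real.exp_pos _).le hq (by omega)
      refine (Real.hasSum_pow_div_log_of_abs_lt_one hx).congr_fun fun k => ?_
      rw [lambertTerm, ← pow_mul, ← Real.exp_nat_mul, div_eq_inv_mul]
      push_cast
      congr 2
      ring
  simpa [lambertSum] using h.neg

/-- On the imaginary axis all factors of the eta product are positive reals, so its modulus is the
exponential of the sum of their logarithms. -/
lemma norm_eta_I_mul {r : ℝ} (hr : 0 < r) :
    ‖ModularForm.eta (Complex.I * r)‖ = Real.exp (-(Real.pi / 12 * r) - lambertSum r) := by
  have hpi := Real.pi_pos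
  have hq : Real.exp (-(2 * Real.pi * r)) < 1 := by
    rw [Real.exp_lt_one_iff]; nlinarith [mul_pos hpi hr]
  have hprod := (hasSum_log_one_sub_exp hr).rexp
  have hc := hprod.map Complex.ofRealHom Complex.continuous_ofReal
  have e : (Complex.ofRealHom ∘ (Real.exp ∘ fun m : ℕ =>
      Real.log (1 - Real.exp (-(2 * Real.pi * r)) ^ (m + 1)))) =
      fun m : ℕ => 1 - ModularForm.eta_q m (Complex.I * r) := by
    ext m
    have hx : 0 < 1 - Real.exp (-(2 * Real.pi * r)) ^ (m + 1) :=
      sub_pos.2 (pow_lt_one₀ (Real.exp_pos _).le hq (by omega))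
    have e1 : 2 * (Real.pi : ℂ) * Complex.I * (Complex.I * r) = -(2 * Real.pi * r) := by
      linear_combination (2 * Real.pi * r : ℂ) * Complex.I_mul_I
    rw [ModularForm.eta_q_eq_pow, e1]
    simp only [Function.comp_apply, Real.exp_log hx, Complex.ofRealHom_eq_coe]
    push_cast
    rfl
  rw [e] at hc
  rw [ModularForm.eta, hc.tprod_eq, norm_mul, Function.Periodic.norm_qParam,
    Complex.ofRealHom_eq_coe, Complex.norm_real, Real.norm_of_nonneg (Real.exp_pos _).le,
    ← Real.exp_add]
  congr 1
  simp
  ring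

/-- With `r = 1/L²`, the term `log r / 4` is the logarithm of `L ^ (-1/2)`. -/
lemma sqrt_eta_eq_exp_logDet {L : ℝ} (hL : 0 < L) :
    Real.sqrt (‖ModularForm.eta (Complex.I / (L : ℂ) ^ 2)‖ ^ 2 / (2 * L)) =
      Real.exp (logDet (L ^ 2)⁻¹ - Real.log 2 / 2) := by
  have hr : 0 < (L ^ 2)⁻¹ := by positivity
  have e : Complex.I / (L : ℂ) ^ 2 = Complex.I * (((L ^ 2)⁻¹ : ℝ) : ℂ) := by
    push_cast; rw [div_eq_mul_inv]
  have e2 : (2 * L) = Real.exp (Real.log 2 + Real.log L) := by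
    rw [Real.exp_add, Real.exp_log two_pos, Real.exp_log hL]
  rw [e, norm_eta_I_mul hr, e2, ← Real.exp_nat_mul, ← Real.exp_sub, Real.sqrt_eq_rpow,
    ← Real.exp_mul]
  congr 1
  rw [logDet, Real.log_inv, Real.log_pow]
  push_cast
  ring

/-- The contributions of `log π` to `log A / 4` and `log (2π) / 2` cancel. -/
lemma exp_logDet_eq_cexp_neg_deriv {L : ℝ} (hL : 0 < L) :
    ((Real.exp (logDet (L ^ 2)⁻¹ - Real.log 2 / 2) : ℝ) : ℂ) =
      Complex.exp (-deriv (rectZeta ((Real.pi / L) ^ 2) ((Real.pi * L) ^ 2)) 0) := by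
  have hpi := Real.pi_pos
  have hA : 0 < (Real.pi / L) ^ 2 := by positivity
  have hB : 0 < (Real.pi * L) ^ 2 := by positivity
  rw [(hasDerivAt_rectZeta_zero hA hB).deriv, ← Complex.ofReal_neg, ← Complex.ofReal_exp]
  congr 2
  have e : √((Real.pi / L) ^ 2 / (Real.pi * L) ^ 2) = (L ^ 2)⁻¹ := by
    rw [← div_pow, Real.sqrt_sq (by positivity)]
    field_simp
  rw [e, logDet, Real.log_inv, Real.log_pow, Real.log_pow, Real.log_div hpi.ne' hL.ne',
    Real.log_mul two_ne_zero hpi.ne']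
  push_cast
  ring

/-! ### The rectangle -/

lemma mem_rectangle {L : ℝ} {x : Plane} :
    x ∈ (rectangle L : Set Plane) ↔ 0 < x 0 ∧ x 0 < L ∧ 0 < x 1 ∧ x 1 < L⁻¹ := Iff.rfl

/-- The closed rectangle `[0, L] × [0, 1/L]`. -/
def closedRectangle (L : ℝ) : Set Plane := {x | 0 ≤ x 0 ∧ x 0 ≤ L ∧ 0 ≤ x 1 ∧ x 1 ≤ L⁻¹}

lemma continuous_coord (i : Fin 2) : Continuous fun x : Plane => x i := by fun_prop

lemma isCompact_closedRectangle (L : ℝ) : IsCompact (closedRectangle L) := by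
  refine Metric.isCompact_of_isClosed_isBounded ?_ ?_
  · exact (isClosed_le continuous_const (continuous_coord 0)).inter
      ((isClosed_le (continuous_coord 0) continuous_const).inter
        ((isClosed_le continuous_const (continuous_coord 1)).inter
          (isClosed_le (continuous_coord 1) continuous_const)))
  · refine (Metric.isBounded_iff_subset_closedBall (0 : Plane)).2 ⟨L + L⁻¹, fun x hx => ?_⟩
    obtain ⟨h1, h2, h3, h4⟩ := hx
    rw [mem_closedBall_zero_iff, EuclideanSpace.norm_eq, Fin.sum_univ_two]
    refine Real.sqrt_le_iff.2 ⟨by linarith, ?_⟩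
    simp only [Real.norm_eq_abs, sq_abs]
    nlinarith [mul_nonneg (h1.trans h2) (h3.trans h4)]

lemma rectangle_subset_closedRectangle (L : ℝ) : (rectangle L : Set Plane) ⊆ closedRectangle L :=
  fun _ ⟨h1, h2, h3, h4⟩ => ⟨h1.le, h2.le, h3.le, h4.le⟩

instance isFiniteMeasure_rectangle (L : ℝ) :
    IsFiniteMeasure ((volume : Measure Plane).restrict (rectangle L : Set Plane)) :=
  isFiniteMeasure_restrict.2 ((measure_mono (rectangle_subset_closedRectangle L)).trans_lt
    (isCompact_closedRectangle L).measure_lt_top).ne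

lemma measurableSet_rectangle (L : ℝ) : MeasurableSet (rectangle L : Set Plane) :=
  (rectangle L).isOpen.measurableSet

/-! ### Products of sines -/

/-- The function `sin (a x) sin (b y)`. -/
def mode (a b : ℝ) (x : Plane) : ℝ := Real.sin (a * x 0) * Real.sin (b * x 1)

/-- The partial derivatives of `sin (a x) sin (b y)`. -/
def modeDeriv (a b : ℝ) (i : Fin 2) (x : Plane) : ℝ :=
  ![a * Real.cos (a * x 0) * Real.sin (b * x 1), Real.sin (a * x 0) * (b * Real.cos (b * x 1))] i

/-- The component of the gradient of `sin (a x) sin (b y)` in the direction of a coordinate. -/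
def modePartial (a b : ℝ) (i : Fin 2) (x : Plane) : Plane :=
  EuclideanSpace.single i (modeDeriv a b i x)

lemma hasGradientAt_coord_mul_coord {s t : ℝ → ℝ} {s' t' : ℝ} {x : Plane}
    (hs : HasDerivAt s s' (x 0)) (ht : HasDerivAt t t' (x 1)) :
    HasGradientAt (fun x : Plane => s (x 0) * t (x 1))
      (EuclideanSpace.single 0 (s' * t (x 1)) + EuclideanSpace.single 1 (s (x 0) * t')) x := by
  have p0 : HasFDerivAt (fun x : Plane => x 0) (EuclideanSpace.proj (𝕜 := ℝ) (0 : Fin 2)) x :=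
    (EuclideanSpace.proj (𝕜 := ℝ) (0 : Fin 2) : Plane →L[ℝ] ℝ).hasFDerivAt
  have p1 : HasFDerivAt (fun x : Plane => x 1) (EuclideanSpace.proj (𝕜 := ℝ) (1 : Fin 2)) x :=
    (EuclideanSpace.proj (𝕜 := ℝ) (1 : Fin 2) : Plane →L[ℝ] ℝ).hasFDerivAt
  rw [hasGradientAt_iff_hasFDerivAt]
  refine ((hs.comp_hasFDerivAt x p0).mul (ht.comp_hasFDerivAt x p1)).congr_fderiv ?_
  ext v
  simp [EuclideanSpace.inner_single_left]
  ring

lemma hasDerivAt_sin_mul (a y : ℝ) :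
    HasDerivAt (fun y => Real.sin (a * y)) (a * Real.cos (a * y)) y := by
  refine ((Real.hasDerivAt_sin (a * y)).comp y ((hasDerivAt_id y).const_mul a)).congr_deriv ?_
  ring

lemma hasDerivAt_mul_cos_mul (a y : ℝ) :
    HasDerivAt (fun y => a * Real.cos (a * y)) (-a ^ 2 * Real.sin (a * y)) y := by
  refine (((Real.hasDerivAt_cos (a * y)).comp y ((hasDerivAt_id y).const_mul a)).const_mul
    a).congr_deriv ?_
  ring

lemma hasGradientAt_mode (a b : ℝ) (x : Plane) :
    HasGradientAt (mode a b) (modePartial a b 0 x + modePartial a b 1 x) x :=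
  hasGradientAt_coord_mul_coord (hasDerivAt_sin_mul a (x 0)) (hasDerivAt_sin_mul b (x 1))

lemma contDiff_mode (a b : ℝ) : ContDiff ℝ (⊤ : ℕ∞) (mode a b) := by
  unfold mode; fun_prop

lemma continuous_mode (a b : ℝ) : Continuous (mode a b) := (contDiff_mode a b).continuous

lemma contDiff_modeDeriv (a b : ℝ) (i : Fin 2) : ContDiff ℝ (⊤ : ℕ∞) (modeDeriv a b i) := by
  unfold modeDeriv
  fin_cases i
  · simp only [Fin.zero_eta, Matrix.cons_val_zero]; fun_prop
  · simp only [Fin.mk_one, Matrix.cons_val_one, Matrix.cons_val_zero]; fun_prop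

lemma fderiv_modeDeriv (a b : ℝ) (i : Fin 2) (x : Plane) :
    fderiv ℝ (modeDeriv a b i) x (EuclideanSpace.single i 1) = -(![a, b] i) ^ 2 * mode a b x := by
  fin_cases i
  · have h : HasGradientAt (modeDeriv a b 0) _ x := hasGradientAt_coord_mul_coord
      (hasDerivAt_mul_cos_mul a (x 0)) (hasDerivAt_sin_mul b (x 1))
    simp only [Fin.zero_eta]
    rw [h.fderiv_apply, EuclideanSpace.inner_single_right]
    simp [mode, mul_assoc]
  · have h : HasGradientAt (modeDeriv a b 1) _ x := hasGradientAt_coord_mul_coord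
      (hasDerivAt_sin_mul a (x 0)) (hasDerivAt_mul_cos_mul b (x 1))
    simp only [Fin.mk_one]
    rw [h.fderiv_apply, EuclideanSpace.inner_single_right]
    simp [mode]
    ring

lemma abs_mode_le (a b : ℝ) (x : Plane) : |mode a b x| ≤ 1 := by
  rw [mode, abs_mul]
  exact mul_le_one₀ (Real.abs_sin_le_one _) (abs_nonneg _) (Real.abs_sin_le_one _)

lemma abs_modeDeriv_le (a b : ℝ) (i : Fin 2) (x : Plane) : |modeDeriv a b i x| ≤ |a| + |b| := by
  have ha := abs_nonneg a
  have hb := abs_nonneg b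
  fin_cases i
  · simp only [modeDeriv, Fin.zero_eta, Matrix.cons_val_zero, abs_mul]
    calc |a| * |Real.cos (a * x 0)| * |Real.sin (b * x 1)| ≤ |a| * 1 * 1 := by
          gcongr
          · exact Real.abs_cos_le_one _
          · exact Real.abs_sin_le_one _
      _ ≤ _ := by linarith
  · simp only [modeDeriv, Fin.mk_one, Matrix.cons_val_one, Matrix.cons_val_zero, abs_mul]
    calc |Real.sin (a * x 0)| * (|b| * |Real.cos (b * x 1)|) ≤ 1 * (|b| * 1) := by
          gcongr
          · exact Real.abs_sin_le_one _
          · exact Real.abs_cos_le_one _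
      _ ≤ _ := by linarith

lemma norm_modePartial_le (a b : ℝ) (i : Fin 2) (x : Plane) :
    ‖modePartial a b i x‖ ≤ |a| + |b| := by
  simpa [modePartial] using abs_modeDeriv_le a b i x

lemma continuous_modePartial (a b : ℝ) (i : Fin 2) : Continuous (modePartial a b i) := by
  have h := (contDiff_modeDeriv a b i).continuous
  have e : modePartial a b i = fun x => modeDeriv a b i x • EuclideanSpace.single i (1 : ℝ) := by
    ext x j
    simp [modePartial]
  rw [e]
  fun_prop

lemma memLp_mode (a b L : ℝ) :
    MemLp (mode a b) 2 ((volume : Measure Plane).restrict (rectangle L : Set Plane)) :=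
  MemLp.of_bound (continuous_mode a b).aestronglyMeasurable 1
    (.of_forall fun x => abs_mode_le a b x)

lemma memLp_modePartial (a b L : ℝ) (i : Fin 2) :
    MemLp (modePartial a b i) 2 ((volume : Measure Plane).restrict (rectangle L : Set Plane)) :=
  MemLp.of_bound (continuous_modePartial a b i).aestronglyMeasurable (|a| + |b|)
    (.of_forall fun x => norm_modePartial_le a b i x)

/-- The class of `sin (a x) sin (b y)` in `L²` of the rectangle. -/
def modeLp (a b L : ℝ) : L2 (rectangle L) := (memLp_mode a b L).toLp

/-- The class of a component of the gradient of `sin (a x) sin (b y)` in `L²` of the rectangle. -/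
def modePartialLp (a b L : ℝ) (i : Fin 2) : L2Vec (rectangle L) := (memLp_modePartial a b L i).toLp

/-! ### Integration by parts -/

/-- Since `φ` has compact support in `Ω`, the integrals extend to the whole plane and no boundary
term appears. -/
lemma integral_modeDeriv_mul_fderiv (a b : ℝ) (i : Fin 2) {Ω : Opens Plane} (φ : 𝓓(Ω, ℝ)) :
    ∫ x in (Ω : Set Plane), modeDeriv a b i x * fderiv ℝ φ x (EuclideanSpace.single i 1) =
      (![a, b] i) ^ 2 * ∫ x in (Ω : Set Plane), mode a b x * φ x := by
  have hφ0 : ∀ x ∉ (Ω : Set Plane), φ x = 0 := fun x hx =>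
    image_eq_zero_of_notMem_tsupport fun h => hx (φ.tsupport_subset h)
  have hφ1 : ∀ x ∉ (Ω : Set Plane), fderiv ℝ φ x = 0 := fun x hx =>
    image_eq_zero_of_notMem_tsupport fun h =>
      hx (φ.tsupport_subset (tsupport_fderiv_subset ℝ h))
  have hd : Continuous fun x => fderiv ℝ φ x (EuclideanSpace.single i 1) :=
    (φ.contDiff.continuous_fderiv (by simp)).clm_apply continuous_const
  have hm := contDiff_modeDeriv a b i
  have cs : HasCompactSupport φ := φ.hasCompactSupport
  have csd : HasCompactSupport fun x => fderiv ℝ φ x (EuclideanSpace.single i 1) :=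
    cs.fderiv_apply ℝ _
  have hc : Continuous fun x => fderiv ℝ (modeDeriv a b i) x (EuclideanSpace.single i 1) :=
    (hm.continuous_fderiv (by simp)).clm_apply continuous_const
  have key := integral_mul_fderiv_eq_neg_fderiv_mul_of_integrable (μ := (volume : Measure Plane))
    (f := modeDeriv a b i) (g := φ) (v := EuclideanSpace.single i 1)
    ((hc.mul φ.continuous).integrable_of_hasCompactSupport cs.mul_left)
    ((hm.continuous.mul hd).integrable_of_hasCompactSupport csd.mul_left)
    ((hm.continuous.mul φ.continuous).integrable_of_hasCompactSupport cs.mul_left)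
    (fun x _ => hm.differentiable (by simp) x) (fun x _ => testFunction_differentiable φ x)
  rw [setIntegral_eq_integral_of_forall_compl_eq_zero fun x hx => by simp [hφ1 x hx],
    setIntegral_eq_integral_of_forall_compl_eq_zero fun x hx => by simp [hφ0 x hx], key,
    ← integral_const_mul, ← integral_neg]
  congr 1
  ext x
  rw [fderiv_modeDeriv]
  ring

/-- Both sides are continuous in `w`, so test functions suffice. Keeping the two directions apart
later allows modes with equal eigenvalues to be separated. -/
lemma inner_modePartialLp (a b L : ℝ) (i : Fin 2) {w : L2 (rectangle L) × L2Vec (rectangle L)}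
    (hw : w ∈ sobolevH10 (rectangle L)) :
    inner ℝ (modePartialLp a b L i) w.2 = (![a, b] i) ^ 2 * inner ℝ (modeLp a b L) w.1 := by
  have hcl : IsClosed {w : L2 (rectangle L) × L2Vec (rectangle L) |
      inner ℝ (modePartialLp a b L i) w.2 = (![a, b] i) ^ 2 * inner ℝ (modeLp a b L) w.1} :=
    isClosed_eq (by fun_prop) (by fun_prop)
  refine closure_minimal (s := (testGradientGraph (rectangle L) : Set _)) ?_ hcl
    (show w ∈ closure (testGradientGraph (rectangle L) : Set _) from hw)
  rintro p ⟨φ, h1, h2⟩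
  simp only [mem_ofPred_eq]
  have e1 : inner ℝ (modePartialLp a b L i) p.2 = ∫ x in (rectangle L : Set Plane),
      modeDeriv a b i x * fderiv ℝ φ x (EuclideanSpace.single i 1) := by
    rw [L2.inner_def]
    refine integral_congr_ae ?_
    filter_upwards [h2, (memLp_modePartial a b L i).coeFn_toLp] with x hx hx'
    have hg := (testFunction_differentiable φ x).hasGradientAt.fderiv_apply
      (y := EuclideanSpace.single i (1 : ℝ))
    rw [modePartialLp, hx', hx, hg, modePartial, EuclideanSpace.inner_single_left,
      EuclideanSpace.inner_single_right]
    simp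
  have e2 : inner ℝ (modeLp a b L) p.1 = ∫ x in (rectangle L : Set Plane), mode a b x * φ x := by
    rw [L2.inner_def]
    refine integral_congr_ae ?_
    filter_upwards [h1, (memLp_mode a b L).coeFn_toLp] with x hx hx'
    rw [modeLp, hx', hx]
    simp [mul_comm]
  rw [e1, e2, integral_modeDeriv_mul_fderiv]

/-! ### Products of sines belong to `H¹₀` -/

/-- Bounded convergence in `L²`, by Vitali's theorem: a uniform bound gives uniform integrability,
because the functions a.e. never reach the level `|C| + 1`. -/
lemma tendsto_toLp_of_bounded {α E : Type*} [MeasurableSpace α] [NormedAddCommGroup E]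
    {μ : Measure α} [IsFiniteMeasure μ] {f : ℕ → α → E} {g : α → E} (hf : ∀ n, MemLp (f n) 2 μ)
    (hg : MemLp g 2 μ) (C : ℝ) (hb : ∀ n, ∀ᵐ x ∂μ, ‖f n x‖ ≤ C)
    (ht : ∀ᵐ x ∂μ, Tendsto (fun n => f n x) atTop (𝓝 (g x))) :
    Tendsto (fun n => (hf n).toLp (f n)) atTop (𝓝 (hg.toLp g)) := by
  rw [Lp.tendsto_Lp_iff_tendsto_eLpNorm'']
  refine tendsto_Lp_finite_of_tendsto_ae (by norm_num) (by norm_num)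
    (fun n => (hf n).aestronglyMeasurable) hg ?_ ht
  refine unifIntegrable_of (by norm_num) (by norm_num) (fun n => (hf n).aestronglyMeasurable)
    fun ε _ => ⟨(|C| + 1).toNNReal, fun n => ?_⟩
  have : ({x | (|C| + 1).toNNReal ≤ ‖f n x‖₊}.indicator (f n)) =ᵐ[μ] 0 := by
    filter_upwards [hb n] with x hx
    refine indicator_of_notMem (fun h => ?_) _
    have h' : (|C| + 1).toNNReal ≤ ‖f n x‖₊ := h
    rw [Real.toNNReal_le_iff_le_coe, coe_nnnorm] at h'
    linarith [le_abs_self C]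
  rw [eLpNorm_congr_ae this]
  simp

lemma abs_sin_nat_mul_le (n : ℕ) (x : ℝ) : |Real.sin (n * x)| ≤ n * |Real.sin x| := by
  induction n with
  | zero => simp
  | succ n ih =>
    have e : ((n + 1 : ℕ) : ℝ) * x = n * x + x := by push_cast; ring
    rw [e, Real.sin_add]
    refine (abs_add_le _ _).trans ?_
    rw [abs_mul, abs_mul]
    have h1 := mul_le_mul_of_nonneg_left (Real.abs_cos_le_one x) (abs_nonneg (Real.sin (n * x)))
    have h2 := mul_le_mul_of_nonneg_right (Real.abs_cos_le_one (n * x)) (abs_nonneg (Real.sin x))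
    push_cast
    linarith

/-- At `t = Nρ - 1`, with `ρ` the first eigenfunction, the factor `t + 1` is `Nρ`: this is the
quantity that appears when the cutoff is differentiated. -/
lemma exists_bound_deriv_smoothTransition :
    ∃ C : ℝ, ∀ t : ℝ, |(t + 1) * deriv Real.smoothTransition t| ≤ C := by
  have hc : Continuous fun t : ℝ => (t + 1) * deriv Real.smoothTransition t :=
    (continuous_id.add continuous_const).mul
      ((Real.smoothTransition.contDiff (n := 1)).continuous_deriv (by simp))
  have hs : HasCompactSupport fun t : ℝ => (t + 1) * deriv Real.smoothTransition t := by
    refine HasCompactSupport.intro (isCompact_Icc (a := (0 : ℝ)) (b := 1)) fun t ht => ?_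
    rw [mem_Icc, not_and_or, not_le, not_le] at ht
    have hd : deriv Real.smoothTransition t = 0 := by
      rcases ht with ht | ht
      · have : Real.smoothTransition =ᶠ[𝓝 t] fun _ => 0 := by
          filter_upwards [Iio_mem_nhds ht] with y hy
          exact Real.smoothTransition.zero_of_nonpos (le_of_lt hy)
        rw [this.deriv_eq, deriv_const]
      · have : Real.smoothTransition =ᶠ[𝓝 t] fun _ => 1 := by
          filter_upwards [Ioi_mem_nhds ht] with y hy
          exact Real.smoothTransition.one_of_one_le (le_of_lt hy)
        rw [this.deriv_eq, deriv_const]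
    rw [hd, mul_zero]
  exact hc.bounded_above_of_compact_support hs

/-- The first eigenfunction of the rectangle. -/
def groundState (L : ℝ) : Plane → ℝ := mode (Real.pi / L) (Real.pi * L)

lemma sin_scaled_pos {c t : ℝ} (ht : 0 < t) (htc : t < c) : 0 < Real.sin (Real.pi / c * t) := by
  have hc : 0 < c := ht.trans htc
  refine Real.sin_pos_of_pos_of_lt_pi (by positivity) ?_
  rw [div_mul_eq_mul_div, div_lt_iff₀ hc]
  exact mul_lt_mul_of_pos_left htc Real.pi_pos

lemma pi_mul_eq_pi_div_inv (L : ℝ) : Real.pi * L = Real.pi / L⁻¹ := by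
  rw [div_inv_eq_mul]

lemma groundState_pos {L : ℝ} {x : Plane} (hx : x ∈ (rectangle L : Set Plane)) :
    0 < groundState L x := by
  obtain ⟨h1, h2, h3, h4⟩ := hx
  rw [groundState, mode, pi_mul_eq_pi_div_inv]
  exact mul_pos (sin_scaled_pos h1 h2) (sin_scaled_pos h3 h4)

lemma groundState_eq_zero {L : ℝ} (hL : 0 < L) {x : Plane} (hx : x ∈ closedRectangle L)
    (hx' : x ∉ (rectangle L : Set Plane)) : groundState L x = 0 := by
  obtain ⟨h1, h2, h3, h4⟩ := hx
  rw [mem_rectangle] at hx'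
  rw [groundState, mode]
  rcases h1.eq_or_lt with h1 | h1
  · simp [← h1]
  rcases h2.eq_or_lt with h2 | h2
  · simp [h2, hL.ne']
  rcases h3.eq_or_lt with h3 | h3
  · simp [← h3]
  rcases h4.eq_or_lt with h4 | h4
  · simp [h4, hL.ne']
  exact absurd ⟨h1, h2, h3, h4⟩ hx'

/-- Every mode vanishes at the boundary at least as fast as the first one, which compensates the
factor `N` in the gradient of the cutoff. -/
lemma abs_mode_le_groundState {L : ℝ} (m n : ℕ) (x : Plane) :
    |mode (m * (Real.pi / L)) (n * (Real.pi * L)) x| ≤ m * n * |groundState L x| := by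
  rw [mode, groundState, mode, abs_mul, abs_mul, mul_assoc (m : ℝ), mul_assoc (n : ℝ)]
  calc _ ≤ (m * |Real.sin (Real.pi / L * x 0)|) * (n * |Real.sin (Real.pi * L * x 1)|) :=
        mul_le_mul (abs_sin_nat_mul_le _ _) (abs_sin_nat_mul_le _ _) (abs_nonneg _) (by positivity)
    _ = _ := by ring

/-- A cutoff function on the rectangle, equal to one away from the boundary as `N` grows. -/
def cutoff (L : ℝ) (N : ℕ) (x : Plane) : ℝ := Real.smoothTransition (N * groundState L x - 1)

lemma contDiff_cutoff (L : ℝ) (N : ℕ) : ContDiff ℝ (⊤ : ℕ∞) (cutoff L N) :=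
  Real.smoothTransition.contDiff.comp
    ((contDiff_const.mul (contDiff_mode _ _)).sub contDiff_const)

/-- The gradient of the product of `sin (a x) sin (b y)` and a cutoff function. -/
def cutoffGrad (a b L : ℝ) (N : ℕ) (x : Plane) : Plane :=
  cutoff L N x • (modePartial a b 0 x + modePartial a b 1 x) +
    (mode a b x * (deriv Real.smoothTransition (N * groundState L x - 1) * N)) •
      (modePartial (Real.pi / L) (Real.pi * L) 0 x + modePartial (Real.pi / L) (Real.pi * L) 1 x)

lemma hasGradientAt_mode_mul_cutoff (a b L : ℝ) (N : ℕ) (x : Plane) :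
    HasGradientAt (fun x => mode a b x * cutoff L N x) (cutoffGrad a b L N x) x := by
  have h1 := (hasGradientAt_mode a b x).hasFDerivAt
  have h2 : HasFDerivAt (groundState L) _ x :=
    (hasGradientAt_mode (Real.pi / L) (Real.pi * L) x).hasFDerivAt
  have h3 : HasDerivAt Real.smoothTransition
      (deriv Real.smoothTransition (N * groundState L x - 1)) (N * groundState L x - 1) :=
    ((Real.smoothTransition.contDiff (n := 1)).differentiable (by simp) _).hasDerivAt
  rw [hasGradientAt_iff_hasFDerivAt]
  refine (h1.mul (h3.comp_hasFDerivAt x ((h2.const_mul (N : ℝ)).sub_const 1))).congr_fderiv ?_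
  ext v
  simp [cutoffGrad, cutoff]
  ring

lemma cutoff_eq_zero {L : ℝ} {N : ℕ} {x : Plane} (h : (N : ℝ) * groundState L x < 1) :
    cutoff L N x = 0 :=
  Real.smoothTransition.zero_of_nonpos (by linarith)

/-- The part of the closed rectangle where the cutoff function need not vanish. -/
def cutoffSupport (L : ℝ) (N : ℕ) : Set Plane :=
  closedRectangle L ∩ {x | 1 ≤ (N : ℝ) * groundState L x}

lemma isCompact_cutoffSupport (L : ℝ) (N : ℕ) : IsCompact (cutoffSupport L N) :=
  (isCompact_closedRectangle L).inter_right
    (isClosed_le continuous_const (continuous_const.mul (continuous_mode _ _)))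

/-- The first eigenfunction vanishes on the boundary, so a positive lower bound keeps the set inside
the open rectangle. -/
lemma cutoffSupport_subset {L : ℝ} (hL : 0 < L) (N : ℕ) :
    cutoffSupport L N ⊆ (rectangle L : Set Plane) := by
  rintro x ⟨hx, hx'⟩
  by_contra h
  have hx2 : 1 ≤ (N : ℝ) * groundState L x := hx'
  rw [groundState_eq_zero hL hx h, mul_zero] at hx2
  linarith

lemma indicator_mode_mul_cutoff_eq_zero (a b L : ℝ) (N : ℕ) {x : Plane}
    (hx : x ∉ cutoffSupport L N) :
    (rectangle L : Set Plane).indicator (fun x => mode a b x * cutoff L N x) x = 0 := by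
  by_cases hR : x ∈ (rectangle L : Set Plane)
  · rw [indicator_of_mem hR, cutoff_eq_zero, mul_zero]
    by_contra h
    exact hx ⟨rectangle_subset_closedRectangle L hR, not_lt.1 h⟩
  · exact indicator_of_notMem hR _

lemma indicator_eventuallyEq_of_mem (L : ℝ) (f : Plane → ℝ) {x : Plane}
    (hx : x ∈ (rectangle L : Set Plane)) :
    (rectangle L : Set Plane).indicator f =ᶠ[𝓝 x] f := by
  filter_upwards [(rectangle L).isOpen.mem_nhds hx] with y hy using indicator_of_mem hy _

/-- The test function cut out of `sin (a x) sin (b y)` on the rectangle. -/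
def cutoffTest (a b : ℝ) {L : ℝ} (hL : 0 < L) (N : ℕ) : 𝓓(rectangle L, ℝ) where
  -- The indicator is needed because the sine products are periodic, and the cutoff alone need not
  -- vanish outside the rectangle.
  toFun := (rectangle L : Set Plane).indicator (fun x => mode a b x * cutoff L N x)
  contDiff' := by
    rw [contDiff_iff_contDiffAt]
    intro x
    by_cases hx : x ∈ (rectangle L : Set Plane)
    · exact ((contDiff_mode a b).mul (contDiff_cutoff L N)).contDiffAt.congr_of_eventuallyEq
        (indicator_eventuallyEq_of_mem L _ hx)
    · refine (contDiffAt_const (c := (0 : ℝ))).congr_of_eventuallyEq ?_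
      filter_upwards [(isCompact_cutoffSupport L N).isClosed.isOpen_compl.mem_nhds
        fun h => hx (cutoffSupport_subset hL N h)] with y hy
      exact indicator_mode_mul_cutoff_eq_zero a b L N hy
  hasCompactSupport' := HasCompactSupport.intro (isCompact_cutoffSupport L N)
    fun _ hx => indicator_mode_mul_cutoff_eq_zero a b L N hx
  tsupport_subset' := by
    refine (closure_minimal (fun x hx => ?_) (isCompact_cutoffSupport L N).isClosed).trans
      (cutoffSupport_subset hL N)
    by_contra h
    exact hx (indicator_mode_mul_cutoff_eq_zero a b L N h)

lemma cutoffTest_apply (a b : ℝ) {L : ℝ} (hL : 0 < L) (N : ℕ) :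
    (cutoffTest a b hL N : Plane → ℝ) =
      (rectangle L : Set Plane).indicator (fun x => mode a b x * cutoff L N x) := rfl

lemma continuous_cutoffGrad (a b L : ℝ) (N : ℕ) : Continuous (cutoffGrad a b L N) := by
  have h1 := (contDiff_cutoff L N).continuous
  have h2 := continuous_modePartial a b 0
  have h3 := continuous_modePartial a b 1
  have h4 := continuous_modePartial (Real.pi / L) (Real.pi * L) 0
  have h5 := continuous_modePartial (Real.pi / L) (Real.pi * L) 1
  have h6 := continuous_mode a b
  have h7 : Continuous (groundState L) := continuous_mode _ _
  have h8 : Continuous (deriv Real.smoothTransition) :=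
    (Real.smoothTransition.contDiff (n := 1)).continuous_deriv (by simp)
  unfold cutoffGrad
  fun_prop

lemma abs_mode_mul_cutoff_le (a b L : ℝ) (N : ℕ) (x : Plane) :
    ‖mode a b x * cutoff L N x‖ ≤ 1 := by
  rw [Real.norm_eq_abs, abs_mul, cutoff, abs_of_nonneg (Real.smoothTransition.nonneg _)]
  exact mul_le_one₀ (abs_mode_le a b x) (Real.smoothTransition.nonneg _)
    (Real.smoothTransition.le_one _)

lemma norm_modeGrad_le (a b : ℝ) (x : Plane) :
    ‖modePartial a b 0 x + modePartial a b 1 x‖ ≤ 2 * (|a| + |b|) := by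
  refine (norm_add_le _ _).trans ?_
  linarith [norm_modePartial_le a b 0 x, norm_modePartial_le a b 1 x]

lemma exists_bound_cutoffGrad (L : ℝ) (m n : ℕ) : ∃ C : ℝ, ∀ N : ℕ, ∀ x : Plane,
    x ∈ (rectangle L : Set Plane) →
      ‖cutoffGrad (m * (Real.pi / L)) (n * (Real.pi * L)) L N x‖ ≤ C := by
  obtain ⟨C, hC⟩ := exists_bound_deriv_smoothTransition
  refine ⟨2 * (|m * (Real.pi / L)| + |n * (Real.pi * L)|) +
    (m * n * C) * (2 * (|Real.pi / L| + |Real.pi * L|)), fun N x hx => ?_⟩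
  have hρ := groundState_pos hx
  have hC0 : 0 ≤ C := (abs_nonneg _).trans (hC 0)
  refine (norm_add_le _ _).trans (add_le_add ?_ ?_)
  · rw [norm_smul, cutoff, Real.norm_of_nonneg (Real.smoothTransition.nonneg _)]
    exact (mul_le_of_le_one_left (norm_nonneg _) (Real.smoothTransition.le_one _)).trans
      (norm_modeGrad_le _ _ _)
  · rw [norm_smul]
    refine mul_le_mul ?_ (norm_modeGrad_le _ _ _) (norm_nonneg _) (by positivity)
    -- The factor `N` from the chain rule is absorbed by `|mode| ≤ m n ρ`, leaving the bounded
    -- quantity `Nρ |χ'(Nρ - 1)|`, with `χ` the smooth transition.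
    have h1 := hC (N * groundState L x - 1)
    rw [sub_add_cancel, abs_mul, abs_mul, abs_of_pos hρ, Nat.abs_cast] at h1
    have h2 := abs_mode_le_groundState (L := L) m n x
    rw [abs_of_pos hρ] at h2
    rw [Real.norm_eq_abs, abs_mul, abs_mul, Nat.abs_cast]
    calc _ ≤ (m * n * groundState L x) *
          (|deriv Real.smoothTransition (N * groundState L x - 1)| * N) := by gcongr
      _ = m * n * (N * groundState L x *
          |deriv Real.smoothTransition (N * groundState L x - 1)|) := by ring
      _ ≤ _ := by gcongr

lemma eventually_one_lt_mul_groundState {L : ℝ} {x : Plane}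
    (hx : x ∈ (rectangle L : Set Plane)) :
    ∀ᶠ N : ℕ in atTop, 1 < (N : ℝ) * groundState L x - 1 := by
  have h := (tendsto_natCast_atTop_atTop (R := ℝ)).atTop_mul_const (groundState_pos hx)
  filter_upwards [h.eventually_gt_atTop 2] with N hN
  linarith

lemma tendsto_mode_mul_cutoff (a b : ℝ) {L : ℝ} {x : Plane} (hx : x ∈ (rectangle L : Set Plane)) :
    Tendsto (fun N => mode a b x * cutoff L N x) atTop (𝓝 (mode a b x)) := by
  refine tendsto_const_nhds.congr' ?_
  filter_upwards [eventually_one_lt_mul_groundState hx] with N hN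
  rw [cutoff, Real.smoothTransition.one_of_one_le hN.le, mul_one]

lemma tendsto_cutoffGrad (a b : ℝ) {L : ℝ} {x : Plane} (hx : x ∈ (rectangle L : Set Plane)) :
    Tendsto (fun N => cutoffGrad a b L N x) atTop
      (𝓝 (modePartial a b 0 x + modePartial a b 1 x)) := by
  refine tendsto_const_nhds.congr' ?_
  filter_upwards [eventually_one_lt_mul_groundState hx] with N hN
  have hd : deriv Real.smoothTransition (N * groundState L x - 1) = 0 := by
    have : Real.smoothTransition =ᶠ[𝓝 (N * groundState L x - 1)] fun _ => 1 := by
      filter_upwards [Ioi_mem_nhds hN] with y hy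
      exact Real.smoothTransition.one_of_one_le (le_of_lt hy)
    rw [this.deriv_eq, deriv_const]
  rw [cutoffGrad, cutoff, Real.smoothTransition.one_of_one_le hN.le, hd]
  simp

/-- The cut-off modes are test functions. They and their gradients are bounded uniformly in `N` and,
at each point of the rectangle, are eventually equal to their limits, hence converge in `L²`. -/
theorem mode_mem_sobolevH10 {L : ℝ} (hL : 0 < L) (m n : ℕ) :
    (modeLp (m * (Real.pi / L)) (n * (Real.pi * L)) L,
      modePartialLp (m * (Real.pi / L)) (n * (Real.pi * L)) L 0 +
        modePartialLp (m * (Real.pi / L)) (n * (Real.pi * L)) L 1) ∈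
      sobolevH10 (rectangle L) := by
  set a := m * (Real.pi / L) with ha
  set b := n * (Real.pi * L) with hb
  obtain ⟨C, hC⟩ := exists_bound_cutoffGrad L m n
  have hmem := ae_restrict_mem (μ := (volume : Measure Plane)) (measurableSet_rectangle L)
  have b1 : ∀ N, ∀ᵐ x ∂((volume : Measure Plane).restrict (rectangle L : Set Plane)),
      ‖mode a b x * cutoff L N x‖ ≤ 1 := fun N =>
    .of_forall fun x => abs_mode_mul_cutoff_le a b L N x
  have b2 : ∀ N, ∀ᵐ x ∂((volume : Measure Plane).restrict (rectangle L : Set Plane)),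
      ‖cutoffGrad a b L N x‖ ≤ C := fun N => by
    filter_upwards [hmem] with x hx using hC N x hx
  have m1 := fun N => MemLp.of_bound (p := 2) ((continuous_mode a b).mul
    (contDiff_cutoff L N).continuous).aestronglyMeasurable 1 (b1 N)
  have m2 := fun N => MemLp.of_bound (p := 2)
    (continuous_cutoffGrad a b L N).aestronglyMeasurable C (b2 N)
  have t1 := tendsto_toLp_of_bounded m1 (memLp_mode a b L) 1 b1 (by
    filter_upwards [hmem] with x hx using tendsto_mode_mul_cutoff a b hx)
  have t2 := tendsto_toLp_of_bounded m2
    ((memLp_modePartial a b L 0).add (memLp_modePartial a b L 1)) C b2 (by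
    filter_upwards [hmem] with x hx using tendsto_cutoffGrad a b hx)
  rw [MemLp.toLp_add (memLp_modePartial a b L 0) (memLp_modePartial a b L 1)] at t2
  refine mem_closure_of_tendsto (t1.prodMk_nhds t2) (.of_forall fun N => ?_)
  refine ⟨cutoffTest a b hL N, ?_, ?_⟩
  · filter_upwards [hmem, (m1 N).coeFn_toLp] with x hx hx'
    rw [cutoffTest_apply, indicator_of_mem hx]
    exact hx'
  · filter_upwards [hmem, (m2 N).coeFn_toLp] with x hx hx'
    have hg : HasGradientAt (cutoffTest a b hL N : Plane → ℝ) (cutoffGrad a b L N x) x :=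
      (hasGradientAt_mode_mul_cutoff a b L N x).hasFDerivAt.congr_of_eventuallyEq
        (indicator_eventuallyEq_of_mem L _ hx)
    rw [hg.gradient]
    exact hx'

/-! ### Completeness of the products of sines -/

/-- The eigenfunctions of the rectangle as functions on the plane. -/
def eigenFun (L : ℝ) (p : ℕ × ℕ) : Plane → ℝ :=
  mode ((p.1 + 1 : ℕ) * (Real.pi / L)) ((p.2 + 1 : ℕ) * (Real.pi * L))

/-- The linear span of the eigenfunctions of the rectangle. -/
def eigenSpan (L : ℝ) : Submodule ℝ (Plane → ℝ) := Submodule.span ℝ (range (eigenFun L))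

/-- Index `0` is included, where the mode vanishes, since multiplication by a cosine lowers an index
by one. -/
lemma mode_mem_eigenSpan (L : ℝ) (m n : ℕ) :
    mode (m * (Real.pi / L)) (n * (Real.pi * L)) ∈ eigenSpan L := by
  have hz : (m = 0 ∨ n = 0) → mode (m * (Real.pi / L)) (n * (Real.pi * L)) = 0 := by
    rintro (rfl | rfl) <;> ext x <;> simp [mode]
  rcases m with _ | m
  · rw [hz (Or.inl rfl)]; exact zero_mem _
  rcases n with _ | n
  · rw [hz (Or.inr rfl)]; exact zero_mem _
  exact Submodule.subset_span ⟨(m, n), rfl⟩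

/-- The continuous functions which multiply the span of the eigenfunctions into itself. -/
def eigenMultiplier (L : ℝ) : Subalgebra ℝ C(Plane, ℝ) where
  carrier := {g | ∀ f ∈ eigenSpan L, (g : Plane → ℝ) * f ∈ eigenSpan L}
  mul_mem' := by
    intro g h hg hh f hf
    rw [ContinuousMap.coe_mul, mul_assoc]
    exact hg _ (hh f hf)
  add_mem' := by
    intro g h hg hh f hf
    rw [ContinuousMap.coe_add, add_mul]
    exact add_mem (hg f hf) (hh f hf)
  algebraMap_mem' := by
    intro r f hf
    exact (eigenSpan L).smul_mem r hf

/-- The function `cos (c x)` of the coordinate `x`. -/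
def cosCoord (c : ℝ) (i : Fin 2) : C(Plane, ℝ) :=
  ⟨fun x => Real.cos (c * x i), by fun_prop⟩

lemma mem_eigenMultiplier_of_forall {L : ℝ} {g : C(Plane, ℝ)}
    (h : ∀ p, (g : Plane → ℝ) * eigenFun L p ∈ eigenSpan L) : g ∈ eigenMultiplier L := by
  intro f hf
  induction hf using Submodule.span_induction with
  | mem f hf =>
    obtain ⟨p, rfl⟩ := hf
    exact h p
  | zero => rw [mul_zero]; exact zero_mem _
  | add f₁ f₂ _ _ h₁ h₂ => rw [mul_add]; exact add_mem h₁ h₂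
  | smul r f _ hf => rw [mul_smul_comm]; exact (eigenSpan L).smul_mem r hf

lemma cos_mul_sin_succ_mul (m : ℕ) (y : ℝ) :
    Real.cos y * Real.sin ((m + 1 : ℕ) * y) =
      1 / 2 * Real.sin ((m + 2 : ℕ) * y) + 1 / 2 * Real.sin (m * y) := by
  have e1 : ((m + 2 : ℕ) : ℝ) * y = (m + 1 : ℕ) * y + y := by push_cast; ring
  have e2 : (m : ℝ) * y = (m + 1 : ℕ) * y - y := by push_cast; ring
  rw [e1, e2, Real.sin_add, Real.sin_sub]
  ring

lemma cosCoord_zero_mem (L : ℝ) : cosCoord (Real.pi / L) 0 ∈ eigenMultiplier L := by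
  refine mem_eigenMultiplier_of_forall fun p => ?_
  have e : (cosCoord (Real.pi / L) 0 : Plane → ℝ) * eigenFun L p =
      (1 / 2 : ℝ) • mode ((p.1 + 2 : ℕ) * (Real.pi / L)) ((p.2 + 1 : ℕ) * (Real.pi * L)) +
      (1 / 2 : ℝ) • mode (p.1 * (Real.pi / L)) ((p.2 + 1 : ℕ) * (Real.pi * L)) := by
    ext x
    have h := cos_mul_sin_succ_mul p.1 (Real.pi / L * x 0)
    simp only [cosCoord, eigenFun, mode, ContinuousMap.coe_mk, Pi.mul_apply, Pi.add_apply,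
      Pi.smul_apply, smul_eq_mul, mul_assoc] at h ⊢
    linear_combination Real.sin ((p.2 + 1 : ℕ) * (Real.pi * (L * x 1))) * h
  rw [e]
  exact add_mem ((eigenSpan L).smul_mem _ (mode_mem_eigenSpan L _ _))
    ((eigenSpan L).smul_mem _ (mode_mem_eigenSpan L _ _))

lemma cosCoord_one_mem (L : ℝ) : cosCoord (Real.pi * L) 1 ∈ eigenMultiplier L := by
  refine mem_eigenMultiplier_of_forall fun p => ?_
  have e : (cosCoord (Real.pi * L) 1 : Plane → ℝ) * eigenFun L p =
      (1 / 2 : ℝ) • mode ((p.1 + 1 : ℕ) * (Real.pi / L)) ((p.2 + 2 : ℕ) * (Real.pi * L)) +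
      (1 / 2 : ℝ) • mode ((p.1 + 1 : ℕ) * (Real.pi / L)) (p.2 * (Real.pi * L)) := by
    ext x
    have h := cos_mul_sin_succ_mul p.2 (Real.pi * L * x 1)
    simp only [cosCoord, eigenFun, mode, ContinuousMap.coe_mk, Pi.mul_apply, Pi.add_apply,
      Pi.smul_apply, smul_eq_mul, mul_assoc] at h ⊢
    linear_combination Real.sin ((p.1 + 1 : ℕ) * (Real.pi / L * x 0)) * h
  rw [e]
  exact add_mem ((eigenSpan L).smul_mem _ (mode_mem_eigenSpan L _ _))
    ((eigenSpan L).smul_mem _ (mode_mem_eigenSpan L _ _))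

lemma cos_scaled_injOn {c : ℝ} (hc : 0 < c) :
    InjOn (fun t => Real.cos (Real.pi / c * t)) (Icc 0 c) := by
  intro s hs t ht h
  have hm : ∀ t ∈ Icc 0 c, Real.pi / c * t ∈ Icc 0 Real.pi := fun t ht => by
    refine ⟨mul_nonneg (by positivity) ht.1, ?_⟩
    rw [div_mul_eq_mul_div, div_le_iff₀ hc]
    exact mul_le_mul_of_nonneg_left ht.2 Real.pi_pos.le
  exact mul_left_cancel₀ (by positivity : Real.pi / c ≠ 0)
    (Real.injOn_cos (hm s hs) (hm t ht) h)

/-- Multipliers of the span of the eigenfunctions are uniformly dense on the closed rectangle. -/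
lemma exists_eigenMultiplier_near {L : ℝ} (hL : 0 < L) {g : Plane → ℝ} (hg : Continuous g)
    {ε : ℝ} (hε : 0 < ε) :
    ∃ P ∈ eigenMultiplier L, ∀ x ∈ closedRectangle L, |P x - g x| < ε := by
  have : CompactSpace (closedRectangle L) :=
    isCompact_iff_compactSpace.1 (isCompact_closedRectangle L)
  let r : C(Plane, ℝ) →ₐ[ℝ] C(closedRectangle L, ℝ) := ContinuousMap.compRightAlgHom ℝ ℝ
    (⟨Subtype.val, continuous_subtype_val⟩ : C(closedRectangle L, Plane))
  -- For Stone–Weierstrass, the cosines of the two scaled coordinates separate points because `cos`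
  -- is injective on `[0, π]`.
  have hsep : ((eigenMultiplier L).map r).SeparatesPoints := by
    intro x y hxy
    by_cases h0 : (x : Plane) 0 = (y : Plane) 0
    · have h1 : (x : Plane) 1 ≠ (y : Plane) 1 := fun h1 => hxy (by
        ext i
        fin_cases i
        · exact h0
        · exact h1)
      refine ⟨_, ⟨_, ⟨_, cosCoord_one_mem L, rfl⟩, rfl⟩, fun h => h1 ?_⟩
      refine cos_scaled_injOn (inv_pos.2 hL) ⟨x.2.2.2.1, x.2.2.2.2⟩ ⟨y.2.2.2.1, y.2.2.2.2⟩ ?_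
      simp only [← pi_mul_eq_pi_div_inv]
      exact h
    · refine ⟨_, ⟨_, ⟨_, cosCoord_zero_mem L, rfl⟩, rfl⟩, fun h => h0 ?_⟩
      exact cos_scaled_injOn hL ⟨x.2.1, x.2.2.1⟩ ⟨y.2.1, y.2.2.1⟩ h
  obtain ⟨⟨Q, hQ⟩, hQ'⟩ :=
    ContinuousMap.exists_mem_subalgebra_near_continuous_of_separatesPoints _ hsep
      (fun x : closedRectangle L => g x) (hg.comp continuous_subtype_val) ε hε
  obtain ⟨P, hP, rfl⟩ := Subalgebra.mem_map.1 hQ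
  exact ⟨P, hP, fun x hx => hQ' ⟨x, hx⟩⟩

/-- The eigenfunctions of the rectangle as elements of `L²`. -/
def eigenMode (L : ℝ) (p : ℕ × ℕ) : L2 (rectangle L) :=
  modeLp ((p.1 + 1 : ℕ) * (Real.pi / L)) ((p.2 + 1 : ℕ) * (Real.pi * L)) L

lemma eigenMode_coeFn (L : ℝ) (p : ℕ × ℕ) :
    (eigenMode L p : Plane → ℝ) =ᵐ[volume.restrict (rectangle L : Set Plane)] eigenFun L p :=
  (memLp_mode _ _ L).coeFn_toLp

lemma integrable_Lp_rectangle {L : ℝ} (u : L2 (rectangle L)) :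
    Integrable (u : Plane → ℝ) (volume.restrict (rectangle L : Set Plane)) :=
  (Lp.memLp u).integrable (by norm_num)

lemma integrable_Lp_mul_mode {L : ℝ} (u : L2 (rectangle L)) (a b : ℝ) :
    Integrable (fun x => u x * mode a b x) (volume.restrict (rectangle L : Set Plane)) :=
  (integrable_Lp_rectangle u).mul_bdd (c := 1) (continuous_mode a b).aestronglyMeasurable
    (.of_forall fun x => abs_mode_le a b x)

lemma integral_mul_eigenSpan_eq_zero {L : ℝ} {u : L2 (rectangle L)}
    (hu : ∀ p, inner ℝ (eigenMode L p) u = 0) {f : Plane → ℝ} (hf : f ∈ eigenSpan L) :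
    Integrable (fun x => u x * f x) (volume.restrict (rectangle L : Set Plane)) ∧
      ∫ x in (rectangle L : Set Plane), u x * f x = 0 := by
  induction hf using Submodule.span_induction with
  | mem f hf =>
    obtain ⟨p, rfl⟩ := hf
    refine ⟨integrable_Lp_mul_mode u _ _, ?_⟩
    rw [← hu p, L2.inner_def]
    refine integral_congr_ae ?_
    filter_upwards [eigenMode_coeFn L p] with x hx
    rw [hx]
    simp
  | zero => simp
  | add f₁ f₂ _ _ h₁ h₂ =>
    simp only [Pi.add_apply, mul_add]
    exact ⟨h₁.1.add h₂.1, by rw [integral_add h₁.1 h₂.1, h₁.2, h₂.2, add_zero]⟩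
  | smul r f _ hf =>
    simp only [Pi.smul_apply, smul_eq_mul, mul_left_comm _ r]
    exact ⟨hf.1.const_mul r, by rw [integral_const_mul, hf.2, mul_zero]⟩

lemma groundState_mem_eigenSpan (L : ℝ) : groundState L ∈ eigenSpan L := by
  have := mode_mem_eigenSpan L 1 1
  simpa [groundState] using this

/-- Let `v = uρ`, with `ρ` the first eigenfunction. For a multiplier `P` the function `Pρ` lies in
the span of the modes, so `∫ P v = 0`. Multipliers are uniformly dense, hence `∫ g v = 0` for every
test function `g` and `v = 0` almost everywhere; `ρ > 0` gives `u = 0`. -/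
theorem eq_zero_of_inner_eigenMode_eq_zero {L : ℝ} (hL : 0 < L) {u : L2 (rectangle L)}
    (hu : ∀ p, inner ℝ (eigenMode L p) u = 0) : u = 0 := by
  set v : Plane → ℝ := fun x => u x * groundState L x with hv
  have hvi : Integrable v (volume.restrict (rectangle L : Set Plane)) :=
    integrable_Lp_mul_mode u _ _
  have hint : ∀ g : Plane → ℝ, ContDiff ℝ (⊤ : ℕ∞) g → HasCompactSupport g →
      tsupport g ⊆ (rectangle L : Set Plane) → ∫ x, g x • v x = 0 := by
    intro g hg hgc hgs
    rw [← setIntegral_eq_integral_of_forall_compl_eq_zero (s := (rectangle L : Set Plane))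
      fun x hx => by rw [image_eq_zero_of_notMem_tsupport fun h => hx (hgs h), zero_smul]]
    have hbound : ∀ ε : ℝ, 0 < ε → |∫ x in (rectangle L : Set Plane), g x • v x| ≤
        ε * ∫ x in (rectangle L : Set Plane), |v x| := by
      intro ε hε
      obtain ⟨P, hP, hPg⟩ := exists_eigenMultiplier_near hL hg.continuous hε
      have hPv := integral_mul_eigenSpan_eq_zero hu (hP _ (groundState_mem_eigenSpan L))
      have hgv : Integrable (fun x => g x • v x) (volume.restrict (rectangle L : Set Plane)) := by
        obtain ⟨C, hC⟩ := hg.continuous.bounded_above_of_compact_support hgc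
        exact hvi.bdd_mul (c := C) hg.continuous.aestronglyMeasurable (.of_forall hC)
      have e : ∫ x in (rectangle L : Set Plane), g x • v x = ∫ x in (rectangle L : Set Plane),
          (g x • v x - u x * ((P : Plane → ℝ) * groundState L) x) := by
        rw [integral_sub hgv hPv.1, hPv.2, sub_zero]
      rw [e, ← integral_const_mul, ← Real.norm_eq_abs]
      refine norm_integral_le_of_norm_le (hvi.abs.const_mul ε) ?_
      filter_upwards [ae_restrict_mem (measurableSet_rectangle L)] with x hx
      have h1 := hPg x (rectangle_subset_closedRectangle L hx)
      have e2 : g x • v x - u x * ((P : Plane → ℝ) * groundState L) x = -(P x - g x) * v x := by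
        simp only [hv, smul_eq_mul, Pi.mul_apply]; ring
      rw [e2, norm_mul, Real.norm_eq_abs, Real.norm_eq_abs, abs_neg]
      exact mul_le_mul_of_nonneg_right h1.le (abs_nonneg _)
    have hlim : Tendsto (fun ε : ℝ => ε * ∫ x in (rectangle L : Set Plane), |v x|) (𝓝[>] 0)
        (𝓝 0) := by
      have := (tendsto_id (x := 𝓝 (0 : ℝ))).mul_const (∫ x in (rectangle L : Set Plane), |v x|)
      rw [zero_mul] at this
      exact this.mono_left nhdsWithin_le_nhds
    have h0 := ge_of_tendsto hlim (by
      filter_upwards [self_mem_nhdsWithin] with ε hε using hbound ε hε)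
    exact abs_nonpos_iff.1 h0
  have hae := (rectangle L).isOpen.ae_eq_zero_of_integral_contDiff_smul_eq_zero
    (μ := (volume : Measure Plane)) (IntegrableOn.locallyIntegrableOn hvi) hint
  rw [Lp.eq_zero_iff_ae_eq_zero]
  filter_upwards [(ae_restrict_iff' (measurableSet_rectangle L)).2 hae,
    ae_restrict_mem (measurableSet_rectangle L)] with x hx hxR
  exact (mul_eq_zero.1 hx).resolve_right (groundState_pos hxR).ne'

/-! ### The spectrum of the rectangle -/

/-- The eigenvalues of the rectangle, with multiplicity. -/
def eigenvalue (L : ℝ) (p : ℕ × ℕ) : ℝ :=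
  (Real.pi / L) ^ 2 * ((p.1 : ℝ) + 1) ^ 2 + (Real.pi * L) ^ 2 * ((p.2 : ℝ) + 1) ^ 2

lemma eigenvalue_pos {L : ℝ} (hL : 0 < L) (p : ℕ × ℕ) : 0 < eigenvalue L p := by
  have := Real.pi_pos
  unfold eigenvalue
  positivity

/-- The gradients of the eigenfunctions of the rectangle, by components. -/
def eigenPartial (L : ℝ) (p : ℕ × ℕ) (i : Fin 2) : L2Vec (rectangle L) :=
  modePartialLp ((p.1 + 1 : ℕ) * (Real.pi / L)) ((p.2 + 1 : ℕ) * (Real.pi * L)) L i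

/-- The eigenfunctions of the rectangle with their gradients. -/
def eigenPair (L : ℝ) (p : ℕ × ℕ) : L2 (rectangle L) × L2Vec (rectangle L) :=
  (eigenMode L p, eigenPartial L p 0 + eigenPartial L p 1)

lemma eigenPair_mem_sobolevH10 {L : ℝ} (hL : 0 < L) (p : ℕ × ℕ) :
    eigenPair L p ∈ sobolevH10 (rectangle L) :=
  mode_mem_sobolevH10 hL (p.1 + 1) (p.2 + 1)

lemma inner_eigenPair_snd (L : ℝ) (p : ℕ × ℕ) {w : L2 (rectangle L) × L2Vec (rectangle L)}
    (hw : w ∈ sobolevH10 (rectangle L)) :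
    inner ℝ (eigenPair L p).2 w.2 = eigenvalue L p * inner ℝ (eigenMode L p) w.1 := by
  rw [eigenPair, inner_add_left, eigenPartial, eigenPartial, inner_modePartialLp _ _ _ _ hw,
    inner_modePartialLp _ _ _ _ hw, eigenMode, eigenvalue]
  simp only [Matrix.cons_val_zero, Matrix.cons_val_one]
  push_cast
  ring

lemma eigenMode_mem_eigenspace {L : ℝ} (hL : 0 < L) (p : ℕ × ℕ) :
    eigenMode L p ∈ eigenspace (rectangle L) (eigenvalue L p) := by
  refine ⟨(eigenPair L p).2, eigenPair_mem_sobolevH10 hL p, fun w hw => ?_⟩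
  rw [inner_eigenPair_snd L p hw]
  simp [real_inner_smul_left]

/-- Symmetry of the Dirichlet form: the weak equations of `u` and of the mode are tested against
each other. -/
lemma inner_eigenMode_eq_zero_of_mem_eigenspace {L : ℝ} (hL : 0 < L) {μ : ℝ}
    {u : L2 (rectangle L)} (hu : u ∈ eigenspace (rectangle L) μ) {p : ℕ × ℕ}
    (hp : eigenvalue L p ≠ μ) : inner ℝ (eigenMode L p) u = 0 := by
  obtain ⟨G, hG, h⟩ := hu
  have h1 : inner ℝ G (eigenPair L p).2 = inner ℝ (μ • u) (eigenMode L p) :=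
    h _ (eigenPair_mem_sobolevH10 hL p)
  have h2 : inner ℝ (eigenPair L p).2 G = eigenvalue L p * inner ℝ (eigenMode L p) u :=
    inner_eigenPair_snd L p hG
  rw [real_inner_comm, h2, real_inner_smul_left, real_inner_comm _ u] at h1
  have h3 : (eigenvalue L p - μ) * inner ℝ (eigenMode L p) u = 0 := by
    rw [sub_mul, sub_eq_zero]
    exact h1
  exact (mul_eq_zero.1 h3).resolve_left (sub_ne_zero.2 hp)

lemma inner_modePartialLp_of_ne (a b a' b' L : ℝ) {i j : Fin 2} (hij : i ≠ j) :
    inner ℝ (modePartialLp a b L i) (modePartialLp a' b' L j) = 0 := by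
  rw [L2.inner_def]
  refine integral_eq_zero_of_ae ?_
  filter_upwards [(memLp_modePartial a b L i).coeFn_toLp,
    (memLp_modePartial a' b' L j).coeFn_toLp] with x hx hx'
  rw [modePartialLp, modePartialLp, hx, hx', modePartial, modePartial,
    EuclideanSpace.inner_single_left]
  simp [hij]

lemma inner_eigenPartial_eigenPair {L : ℝ} (p q : ℕ × ℕ) (i : Fin 2) :
    inner ℝ (eigenPartial L p i) (eigenPair L q).2 =
      inner ℝ (eigenPartial L p i) (eigenPartial L q i) := by
  fin_cases i
  · simp only [Fin.zero_eta, eigenPair, inner_add_right, eigenPartial]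
    rw [inner_modePartialLp_of_ne _ _ _ _ L zero_ne_one, add_zero]
  · simp only [Fin.mk_one, eigenPair, inner_add_right, eigenPartial]
    rw [inner_modePartialLp_of_ne _ _ _ _ L one_ne_zero, zero_add]

/-- The symmetry of the Dirichlet form holds for each partial derivative separately, so distinct
modes are orthogonal even when their eigenvalues coincide. -/
lemma sq_mul_inner_eigenMode_comm {L : ℝ} (hL : 0 < L) (p q : ℕ × ℕ) (i : Fin 2) :
    (![(p.1 + 1 : ℕ) * (Real.pi / L), (p.2 + 1 : ℕ) * (Real.pi * L)] i) ^ 2 *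
        inner ℝ (eigenMode L p) (eigenMode L q) =
      (![(q.1 + 1 : ℕ) * (Real.pi / L), (q.2 + 1 : ℕ) * (Real.pi * L)] i) ^ 2 *
        inner ℝ (eigenMode L p) (eigenMode L q) := by
  have h1 := inner_modePartialLp ((p.1 + 1 : ℕ) * (Real.pi / L)) ((p.2 + 1 : ℕ) * (Real.pi * L))
    L i (eigenPair_mem_sobolevH10 hL q)
  have h2 := inner_modePartialLp ((q.1 + 1 : ℕ) * (Real.pi / L)) ((q.2 + 1 : ℕ) * (Real.pi * L))
    L i (eigenPair_mem_sobolevH10 hL p)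
  have h3 := inner_eigenPartial_eigenPair (L := L) p q i
  have h4 := inner_eigenPartial_eigenPair (L := L) q p i
  refine (h1.symm.trans (h3.trans ((real_inner_comm _ _).trans (h4.symm.trans h2)))).trans ?_
  congr 1
  exact real_inner_comm _ _

lemma inner_eigenMode_of_ne {L : ℝ} (hL : 0 < L) {p q : ℕ × ℕ} (hpq : p ≠ q) :
    inner ℝ (eigenMode L p) (eigenMode L q) = 0 := by
  have key : ∀ {c : ℝ} {m n : ℕ}, 0 < c → m ≠ n →
      ((m + 1 : ℕ) * c) ^ 2 ≠ ((n + 1 : ℕ) * c) ^ 2 := by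
    intro c m n hc hmn h
    have h' := (pow_left_inj₀ (by positivity) (by positivity) two_ne_zero).1 h
    have h2 := mul_right_cancel₀ hc.ne' h'
    have h3 : m + 1 = n + 1 := by exact_mod_cast h2
    omega
  have hpi := Real.pi_pos
  by_cases h : p.1 = q.1
  · have h2 : p.2 ≠ q.2 := fun h2 => hpq (Prod.ext h h2)
    have := sq_mul_inner_eigenMode_comm hL p q 1
    simp only [Matrix.cons_val_one, Matrix.cons_val_zero] at this
    by_contra hne
    exact key (by positivity) h2 (mul_right_cancel₀ hne this)
  · have := sq_mul_inner_eigenMode_comm hL p q 0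
    simp only [Matrix.cons_val_zero] at this
    by_contra hne
    exact key (by positivity) h (mul_right_cancel₀ hne this)

lemma eigenMode_ne_zero {L : ℝ} (hL : 0 < L) (p : ℕ × ℕ) : eigenMode L p ≠ 0 := by
  intro h
  have hae : eigenFun L p =ᵐ[volume.restrict (rectangle L : Set Plane)] 0 :=
    (eigenMode_coeFn L p).symm.trans ((Lp.eq_zero_iff_ae_eq_zero).1 h)
  have heq := Measure.eqOn_open_of_ae_eq hae (rectangle L).isOpen
    (continuous_mode _ _).continuousOn continuousOn_const
  have hm : (0 : ℝ) < (p.1 : ℝ) + 1 := by positivity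
  have hn : (0 : ℝ) < (p.2 : ℝ) + 1 := by positivity
  have hm1 : (1 : ℝ) ≤ (p.1 : ℝ) + 1 := by simp
  have hn1 : (1 : ℝ) ≤ (p.2 : ℝ) + 1 := by simp
  have hLi : 0 < L⁻¹ := inv_pos.2 hL
  -- At this point both sines equal `1`.
  let x : Plane := !₂[L / (2 * ((p.1 : ℝ) + 1)), L⁻¹ / (2 * ((p.2 : ℝ) + 1))]
  have hx0 : x 0 = L / (2 * ((p.1 : ℝ) + 1)) := rfl
  have hx1 : x 1 = L⁻¹ / (2 * ((p.2 : ℝ) + 1)) := rfl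
  have hx : x ∈ (rectangle L : Set Plane) := by
    refine ⟨?_, ?_, ?_, ?_⟩
    · rw [hx0]; positivity
    · rw [hx0]; exact div_lt_self hL (by linarith)
    · rw [hx1]; positivity
    · rw [hx1]; exact div_lt_self hLi (by linarith)
  have h0 := heq hx
  have e0 : ((p.1 + 1 : ℕ) : ℝ) * (Real.pi / L) * x 0 = Real.pi / 2 := by
    rw [hx0]; push_cast; field_simp
  have e1 : ((p.2 + 1 : ℕ) : ℝ) * (Real.pi * L) * x 1 = Real.pi / 2 := by
    rw [hx1]; push_cast; field_simp
  rw [eigenFun, mode, e0, e1] at h0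
  simp at h0

lemma linearIndependent_eigenMode {L : ℝ} (hL : 0 < L) : LinearIndependent ℝ (eigenMode L) :=
  linearIndependent_of_ne_zero_of_inner_eq_zero (eigenMode_ne_zero hL)
    fun _ _ h => inner_eigenMode_of_ne hL h

lemma finite_eigenvalue_eq {L : ℝ} (hL : 0 < L) (μ : ℝ) :
    Finite {p : ℕ × ℕ // eigenvalue L p = μ} := by
  have hpi := Real.pi_pos
  have hA : 0 < (Real.pi / L) ^ 2 := by positivity
  have hB : 0 < (Real.pi * L) ^ 2 := by positivity
  have key : ∀ {c : ℝ} {n : ℕ}, 0 < c → c * ((n : ℝ) + 1) ^ 2 ≤ μ → n ≤ ⌈μ / c⌉₊ := by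
    intro c n hc h
    have h1 : ((n : ℝ) + 1) ^ 2 ≤ μ / c := by rwa [le_div_iff₀' hc]
    have h2 : (n : ℝ) ≤ ⌈μ / c⌉₊ := by
      have : (0 : ℝ) ≤ n := n.cast_nonneg
      exact le_trans (by nlinarith) (h1.trans (Nat.le_ceil _))
    exact_mod_cast h2
  refine Set.Finite.subset (t := {p | eigenvalue L p = μ})
    ((finite_le_nat ⌈μ / (Real.pi / L) ^ 2⌉₊).prod (finite_le_nat ⌈μ / (Real.pi * L) ^ 2⌉₊))
    fun p hp => ?_
  have hp' : eigenvalue L p = μ := hp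
  rw [eigenvalue] at hp'
  have h1 : 0 ≤ (Real.pi / L) ^ 2 * ((p.1 : ℝ) + 1) ^ 2 := by positivity
  have h2 : 0 ≤ (Real.pi * L) ^ 2 * ((p.2 : ℝ) + 1) ^ 2 := by positivity
  exact ⟨key hA (by linarith), key hB (by linarith)⟩

/-- Subtracting from `u` its projection onto the finitely many modes with eigenvalue `μ` leaves a
vector orthogonal to all modes, which is `0` by completeness. -/
theorem eigenspace_eq_span {L : ℝ} (hL : 0 < L) (μ : ℝ) :
    eigenspace (rectangle L) μ =
      Submodule.span ℝ (range fun p : {p : ℕ × ℕ // eigenvalue L p = μ} => eigenMode L p) := by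
  refine le_antisymm (fun u hu => ?_) (Submodule.span_le.2 ?_)
  · have := finite_eigenvalue_eq hL μ
    have := Fintype.ofFinite {p : ℕ × ℕ // eigenvalue L p = μ}
    set v : L2 (rectangle L) := ∑ p : {p : ℕ × ℕ // eigenvalue L p = μ},
      (inner ℝ (eigenMode L p) u / inner ℝ (eigenMode L p) (eigenMode L p)) • eigenMode L p with hv
    have hvm : v ∈ Submodule.span ℝ
        (range fun p : {p : ℕ × ℕ // eigenvalue L p = μ} => eigenMode L p) :=
      Submodule.sum_mem _ fun p _ => Submodule.smul_mem _ _ (Submodule.subset_span ⟨p, rfl⟩)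
    have h0 : u - v = 0 := by
      refine eq_zero_of_inner_eigenMode_eq_zero hL fun q => ?_
      rw [inner_sub_right, hv, inner_sum]
      simp only [real_inner_smul_right]
      by_cases hq : eigenvalue L q = μ
      · rw [Finset.sum_eq_single (⟨q, hq⟩ : {p : ℕ × ℕ // eigenvalue L p = μ})]
        · rw [div_mul_cancel₀, sub_self]
          exact inner_self_ne_zero.2 (eigenMode_ne_zero hL q)
        · intro p _ hp
          rw [inner_eigenMode_of_ne hL (fun h => hp (Subtype.ext h.symm)), mul_zero]
        · exact fun h => absurd (Finset.mem_univ _) h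
      · rw [inner_eigenMode_eq_zero_of_mem_eigenspace hL hu hq, zero_sub, neg_eq_zero]
        refine Finset.sum_eq_zero fun p _ => ?_
        rw [inner_eigenMode_of_ne hL (fun h : q = p => hq (h ▸ p.2)), mul_zero]
    rw [sub_eq_zero.1 h0]
    exact hvm
  · rintro _ ⟨⟨p, rfl⟩, rfl⟩
    exact eigenMode_mem_eigenspace hL p

lemma finrank_eigenspace {L : ℝ} (hL : 0 < L) (μ : ℝ) :
    Module.finrank ℝ (eigenspace (rectangle L) μ) =
      Nat.card {p : ℕ × ℕ // eigenvalue L p = μ} := by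
  have := finite_eigenvalue_eq hL μ
  have := Fintype.ofFinite {p : ℕ × ℕ // eigenvalue L p = μ}
  rw [eigenspace_eq_span hL, Nat.card_eq_fintype_card]
  exact finrank_span_eq_card ((linearIndependent_eigenMode hL).comp _ Subtype.val_injective)

lemma finiteDimensional_eigenspace {L : ℝ} (hL : 0 < L) (μ : ℝ) :
    FiniteDimensional ℝ (eigenspace (rectangle L) μ) := by
  have := finite_eigenvalue_eq hL μ
  rw [eigenspace_eq_span hL]
  exact FiniteDimensional.span_of_finite ℝ (finite_range _)

lemma eigenvalue_mem_positiveEigenvalues {L : ℝ} (hL : 0 < L) (p : ℕ × ℕ) :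
    eigenvalue L p ∈ positiveEigenvalues (rectangle L) :=
  ⟨eigenvalue_pos hL p, (Submodule.ne_bot_iff _).2
    ⟨_, eigenMode_mem_eigenspace hL p, eigenMode_ne_zero hL p⟩⟩

/-- The series over pairs is grouped along the fibres of `eigenvalue L`; the size of a fibre is the
multiplicity. -/
lemma hasSum_positiveEigenvalues {L : ℝ} (hL : 0 < L) {f : ℝ → ℂ} {a : ℂ}
    (h : HasSum (fun p => f (eigenvalue L p)) a) :
    HasSum (fun μ : positiveEigenvalues (rectangle L) =>
      (Module.finrank ℝ (eigenspace (rectangle L) (μ : ℝ)) : ℂ) * f μ) a := by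
  let e : ℕ × ℕ → positiveEigenvalues (rectangle L) := fun p =>
    ⟨eigenvalue L p, eigenvalue_mem_positiveEigenvalues hL p⟩
  have h' := (Equiv.sigmaFiberEquiv e).hasSum_iff.2 h
  refine h'.sigma fun μ => ?_
  let c : {p // e p = μ} ≃ {p : ℕ × ℕ // eigenvalue L p = μ} :=
    Equiv.subtypeEquivRight fun p => Subtype.ext_iff
  have := finite_eigenvalue_eq hL μ
  have : Finite {p // e p = μ} := Finite.of_equiv _ c.symm
  have := Fintype.ofFinite {p // e p = μ}
  have hs := hasSum_fintype fun p : {p // e p = μ} => f μ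
  rw [Finset.sum_const, Finset.card_univ, nsmul_eq_mul, ← Nat.card_eq_fintype_card,
    Nat.card_congr c, ← finrank_eigenspace hL] at hs
  refine hs.congr_fun ?_
  rintro ⟨p, rfl⟩
  rfl

/-- The zeta function of the Dirichlet Laplacian on a rectangle. -/
theorem isSpectralZeta_rectangle {L : ℝ} (hL : 0 < L) :
    IsSpectralZeta (rectangle L) (rectZeta ((Real.pi / L) ^ 2) ((Real.pi * L) ^ 2)) := by
  have hpi := Real.pi_pos
  have hA : 0 < (Real.pi / L) ^ 2 := by positivity
  have hB : 0 < (Real.pi * L) ^ 2 := by positivity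
  exact
    { finite_mult := fun μ _ => finiteDimensional_eigenspace hL μ
      hasSum := fun s hs => hasSum_positiveEigenvalues hL (f := fun μ => (μ : ℂ) ^ (-s))
        (hasSum_rectZeta hA hB hs)
      meromorphic := fun s _ => meromorphicAt_rectZeta hA hB s
      analyticAt_zero := analyticAt_rectZeta_zero hA hB }

/-- The continuation is unique near `0`, so the value does not depend on the chosen `Z`; this also
makes the choice in `zetaDet` harmless. -/
lemma isZetaDeterminant_rectangle_iff {L : ℝ} (hL : 0 < L) {d : ℝ} :
    IsZetaDeterminant (rectangle L) d ↔ d = Real.exp (logDet (L ^ 2)⁻¹ - Real.log 2 / 2) := by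
  constructor
  · rintro ⟨Z, hZ, hd⟩
    rw [hZ.deriv_zero_eq (isSpectralZeta_rectangle hL), ← exp_logDet_eq_cexp_neg_deriv hL] at hd
    exact_mod_cast hd
  · rintro rfl
    exact ⟨_, isSpectralZeta_rectangle hL, exp_logDet_eq_cexp_neg_deriv hL⟩

lemma zetaDet_rectangle {L : ℝ} (hL : 0 < L) :
    zetaDet (rectangle L) = Real.exp (logDet (L ^ 2)⁻¹ - Real.log 2 / 2) := by
  have h : ∃ d, IsZetaDeterminant (rectangle L) d :=
    ⟨_, (isZetaDeterminant_rectangle_iff hL).2 rfl⟩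
  rw [zetaDet, dif_pos h]
  exact (isZetaDeterminant_rectangle_iff hL).1 h.choose_spec

end DirichletDet

end

theorem proposition4 :
    (∀ L : ℝ, 0 < L →
      (∃! d : ℝ, DirichletDet.IsZetaDeterminant (DirichletDet.rectangle L) d) ∧
      DirichletDet.zetaDet (DirichletDet.rectangle L) =
        Real.sqrt (‖ModularForm.eta (Complex.I / (L : ℂ) ^ 2)‖ ^ 2 / (2 * L))) ∧
    (∀ L : ℝ, 0 < L → L ≠ 1 →
      DirichletDet.zetaDet (DirichletDet.rectangle L) <
        DirichletDet.zetaDet (DirichletDet.rectangle 1)) ∧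
    Filter.Tendsto (fun L : ℝ => DirichletDet.zetaDet (DirichletDet.rectangle L))
      (nhdsWithin 0 (Set.Ioi 0)) (nhds 0) ∧
    Filter.Tendsto (fun L : ℝ => DirichletDet.zetaDet (DirichletDet.rectangle L))
      Filter.atTop (nhds 0) := by
  have hexp : Filter.Tendsto (fun r => Real.exp (DirichletDet.logDet r - Real.log 2 / 2))
      Filter.atTop (nhds 0) :=
    Real.tendsto_exp_atBot.comp
      (Filter.tendsto_atBot_add_const_right _ _ DirichletDet.tendsto_logDet_atTop)
  refine ⟨fun L hL => ⟨?_, ?_⟩, fun L hL hL1 => ?_, ?_, ?_⟩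
  · exact ⟨_, (DirichletDet.isZetaDeterminant_rectangle_iff hL).2 rfl,
      fun d hd => (DirichletDet.isZetaDeterminant_rectangle_iff hL).1 hd⟩
  · rw [DirichletDet.zetaDet_rectangle hL, DirichletDet.sqrt_eta_eq_exp_logDet hL]
  · rw [DirichletDet.zetaDet_rectangle hL, DirichletDet.zetaDet_rectangle one_pos,
      Real.exp_lt_exp, one_pow, inv_one]
    have hr : (L ^ 2)⁻¹ ≠ 1 := by
      rw [Ne, inv_eq_one, pow_eq_one_iff_of_nonneg hL.le two_ne_zero]
      exact hL1
    linarith [DirichletDet.logDet_lt_logDet_one (r := (L ^ 2)⁻¹) (by positivity) hr]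
  -- As `L → 0⁺`, the parameter `r = 1/L²` tends to infinity.
  · have hsq : Filter.Tendsto (fun L : ℝ => (L ^ 2)⁻¹) (nhdsWithin 0 (Set.Ioi 0))
        Filter.atTop := by
      refine ((Filter.tendsto_pow_atTop two_ne_zero).comp tendsto_inv_nhdsGT_zero).congr
        fun L => ?_
      simp
    refine (hexp.comp hsq).congr' ?_
    filter_upwards [self_mem_nhdsWithin] with L hL
    exact (DirichletDet.zetaDet_rectangle hL).symm
  -- As `L → ∞`, `r` tends to `0`; by the symmetry `logDet_inv` it may be replaced by `L²`.
  · refine (hexp.comp (Filter.tendsto_pow_atTop (two_ne_zero (α := ℕ)))).congr' ?_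
    filter_upwards [Filter.eventually_gt_atTop 0] with L hL
    rw [DirichletDet.zetaDet_rectangle hL, DirichletDet.logDet_inv (by positivity)]
    rfl
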